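/- Let $\mathbf{Z}=(\mathbf{X}_1,A_1,\dots,\mathbf{X}_T,A_T,Y)\sim\mathbb{P}$, where the covariates $\mathbf{X}_t$ take values in standard Borel spaces, the treatments $A_t$ in $\{0,1\}$, and the outcome $Y$ is real with $\mathbb{E}(Y^2)<\infty$. Write $\mathbf{H}_t=(\mathbf{X}_1,\dots,\mathbf{X}_t,A_1,\dots,A_{t-1})$, $\pi_t(\mathbf{h}_t)=\mathbb{P}(A_t=1\mid\mathbf{H}_t=\mathbf{h}_t)$, $\mu(\mathbf{h}_T,a_T)=\mathbb{E}(Y\mid\mathbf{H}_T=\mathbf{h}_T,A_T=a_T)$, fix $\delta\in(0,\infty)$, and for $t=0,\dots,T$ let $$ m_t(\mathbf{h}_t,a_t)=\sum_{a_{t+1},\dots,a_T\in\{0,1\}}\int \mu(\mathbf{h}_T,a_T)\prod_{s=t+1}^T \frac{a_s\delta\pi_s(\mathbf{h}_s)+(1-a_s)\{1-\pi_s(\mathbf{h}_s)\}}{\delta\pi_s(\mathbf{h}_s)+1-\pi_s(\mathbf{h}_s)}\,d\mathbb{P}(\mathbf{x}_s\mid\mathbf{h}_{s-1},a_{s-1}),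 $$ so that $m_T=\mu$. The incremental effect, as a functional of the distribution of the observations, is $\psi(\delta)=\psi(\delta;\mathbb{P})=m_0$. Consider the nonparametric model, with unknown propensity scores. Its smooth submodels at $\mathbb{P}$ are all families $\{\mathbb{P}_\epsilon:\epsilon\in\mathbb{R}\}$ of distributions of $\mathbf{Z}$ that are dominated by a common $\sigma$-finite measure, satisfy $\mathbb{P}_0=\mathbb{P}$, are differentiable in quadratic mean at $\epsilon=0$ with a score $g\in L^2(\mathbb{P})$, and for which $\mathbb{E}_{\mathbb{P}_\epsilon}(Y^2)$ is bounded for $\epsilon$ near $0$. The efficient influence function of $\psi(\delta)$ at $\mathbb{P}$ is the function $\varphi\in L^2(\mathbb{P})$ with $\mathbb{E}\{\varphi(\mathbf{Z})\}=0$ that lies in the $L^2(\mathbb{P})$-closed linear span of the scores of these submodels and satisfies, for each of them, that $\epsilon\mapsto\psi(\delta;\mathbb{P}_\epsilon)$ is differentiable at $0$ with $$\frac{\partial}{\partial\epsilon}\psi(\delta;\mathbb{P}_\epsilon)\Big|_{\epsilon=0}=\mathbb{E}\{\varphi(\mathbf{Z})g(\mathbf{Z})\}.$$ Theorem. The efficient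 influence function of $\psi(\delta)$ exists, is unique up to $\mathbb{P}$-null sets, and is given by $$ \sum_{t=1}^T \frac{1-\delta}{\delta}\Big[A_t\{1-\pi_t(\mathbf{H}_t)\}-(1-A_t)\delta\pi_t(\mathbf{H}_t)\Big]\left[\frac{\delta\pi_t(\mathbf{H}_t)m_t(\mathbf{H}_t,1)+\{1-\pi_t(\mathbf{H}_t)\}m_t(\mathbf{H}_t,0)}{\delta\pi_t(\mathbf{H}_t)+1-\pi_t(\mathbf{H}_t)}\right]\prod_{s=1}^t\frac{\delta A_s+1-A_s}{\delta\pi_s(\mathbf{H}_s)+1-\pi_s(\mathbf{H}_s)} $$ $$ {}+\left\{\prod_{t=1}^T\frac{\delta A_t+1-A_t}{\delta\pi_t(\mathbf{H}_t)+1-\pi_t(\mathbf{H}_t)}\right\}Y-\psi(\delta). $$ -/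

import Mathlib

open MeasureTheory ProbabilityTheory Filter Topology
open scoped NNReal ENNReal

noncomputable section

/-! ### Efficient influence functions -/

namespace Efficiency

variable {Z : Type*} [MeasurableSpace Z]

/-- Density of a probability measure with respect to `ν`, as a real function. -/
def density (P : ProbabilityMeasure Z) (ν : Measure Z) (z : Z) : ℝ :=
  ((P : Measure Z).rnDeriv ν z).toReal

/-- `Q` is a dominated one-dimensional parametric submodel through `P` at parameter value `0`,
differentiable in quadratic mean there, with score `g`:
`∫ ((√p_ε - √p) / ε - g √p / 2)² dν → 0` as `ε → 0`. -/
structure IsSubmodel (P : ProbabilityMeasure Z) (Q : ℝ → ProbabilityMeasure Z) (g : Z → ℝ) :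
    Prop where
  base : Q 0 = P
  score_memLp : MemLp g 2 (P : Measure Z)
  qmd : ∃ ν : Measure Z, SigmaFinite ν ∧ (∀ ε, (Q ε : Measure Z) ≪ ν) ∧
    Tendsto (fun ε : ℝ => eLpNorm (fun z =>
        (√(density (Q ε) ν z) - √(density P ν z)) / ε - g z / 2 * √(density P ν z)) 2 ν)
      (𝓝[≠] 0) (𝓝 0)

/-- `φ` is the efficient influence function at `P` of the parameter `Ψ` in the model whose
submodels through `P`, paired with their scores, are those selected by `S`: an element of the
space of mean-zero finite-variance functions whose covariance with the score of every submodel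
is the derivative of the parameter along the submodel, and which belongs to the tangent space
(the closed linear span of the scores in `L²(P)`). -/
structure IsEIF (S : (ℝ → ProbabilityMeasure Z) → (Z → ℝ) → Prop)
    (Ψ : ProbabilityMeasure Z → ℝ) (P : ProbabilityMeasure Z) (φ : Z → ℝ) : Prop where
  memLp : MemLp φ 2 (P : Measure Z)
  mean_zero : ∫ z, φ z ∂(P : Measure Z) = 0
  pathwise : ∀ Q g, S Q g →
    HasDerivAt (fun ε => Ψ (Q ε)) (∫ z, φ z * g z ∂(P : Measure Z)) 0
  tangent : ∀ η : ℝ≥0∞, 0 < η →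
    ∃ h ∈ Submodule.span ℝ {g : Z → ℝ | ∃ Q, S Q g},
      eLpNorm (fun z => φ z - h z) 2 (P : Measure Z) < η

end Efficiency

/-! ### Longitudinal data and incremental propensity score interventions

Times `1, …, T` are represented by `Fin T`, so that `t : Fin T` is time `t + 1`. -/

namespace Incremental

variable {T : ℕ}

/-- Covariate and treatment trajectories `((x₁, …, x_T), (a₁, …, a_T))`; `true` is treated. -/
abbrev Traj (X : Fin T → Type*) : Type _ := ((t : Fin T) → X t) × (Fin T → Bool)

/-- Observations: covariates and treatments at all times, and the outcome. -/
abbrev Obs (X : Fin T → Type*) : Type _ := Traj X × ℝ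

/-- The numerical value of a treatment. -/
def ind (b : Bool) : ℝ := if b then 1 else 0

variable {X : Fin T → Type*}

/-- The history just prior to treatment at time `t`: covariates up to and including `t`,
treatments before `t`. -/
def hist (t : Fin T) (w : Traj X) : ((s : Set.Iic t) → X s) × (Set.Iio t → Bool) :=
  (fun s => w.1 s, fun s => w.2 s)

/-- Everything prior to the covariates at time `t`: covariates and treatments before `t`. -/
def prev (t : Fin T) (w : Traj X) : ((s : Set.Iio t) → X s) × (Set.Iio t → Bool) :=
  (fun s => w.1 s, fun s => w.2 s)

variable [∀ t, MeasurableSpace (X t)]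

/-- Propensity score `π_t(h_t) = P(A_t = 1 | H_t = h_t)`, as a function of the trajectory (it
depends on the history `h_t` only). -/
def propensity (P : ProbabilityMeasure (Obs X)) (t : Fin T) (w : Traj X) : ℝ :=
  (condDistrib (fun z : Obs X => z.1.2 t) (fun z : Obs X => hist t z.1) (P : Measure (Obs X))
    (hist t w)).real {true}

/-- Outcome regression `μ(h_T, a_T) = E(Y | H_T = h_T, A_T = a_T)`. -/
def outcomeReg (P : ProbabilityMeasure (Obs X)) (w : Traj X) : ℝ :=
  ∫ y, y ∂(condDistrib (fun z : Obs X => z.2) (fun z : Obs X => z.1) (P : Measure (Obs X)) w)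

/-- The conditional distribution `dP(x_t | h_{t-1}, a_{t-1})`. -/
def covLaw [∀ t, StandardBorelSpace (X t)] [∀ t, Nonempty (X t)]
    (P : ProbabilityMeasure (Obs X)) (t : Fin T) (w : Traj X) : Measure (X t) :=
  condDistrib (fun z : Obs X => z.1.1 t) (fun z : Obs X => prev t z.1) (P : Measure (Obs X))
    (prev t w)

/-- `δ π_t(h_t) + 1 - π_t(h_t)`. -/
def denom (δ : ℝ) (P : ProbabilityMeasure (Obs X)) (t : Fin T) (w : Traj X) : ℝ :=
  δ * propensity P t w + 1 - propensity P t w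

/-- Probability of the treatment `a_t` given `h_t` under the incremental intervention,
`(a_t δ π_t + (1 - a_t)(1 - π_t)) / (δ π_t + 1 - π_t)`. -/
def intervention (δ : ℝ) (P : ProbabilityMeasure (Obs X)) (t : Fin T) (w : Traj X) : ℝ :=
  (ind (w.2 t) * δ * propensity P t w + (1 - ind (w.2 t)) * (1 - propensity P t w)) /
    denom δ P t w

/-- The weight `(δ A_t + 1 - A_t) / (δ π_t(H_t) + 1 - π_t(H_t))`. -/
def weight (δ : ℝ) (P : ProbabilityMeasure (Obs X)) (t : Fin T) (w : Traj X) : ℝ :=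
  (δ * ind (w.2 t) + 1 - ind (w.2 t)) / denom δ P t w

/-- Smooth submodels through `P` of the nonparametric model for the observations: arbitrary
submodels differentiable in quadratic mean, the second moment of the outcome being bounded near
parameter value `0`. -/
def Submodel (P : ProbabilityMeasure (Obs X)) (Q : ℝ → ProbabilityMeasure (Obs X))
    (g : Obs X → ℝ) : Prop :=
  Efficiency.IsSubmodel P Q g ∧
    ∃ C : ℝ≥0, ∀ᶠ ε in 𝓝 (0 : ℝ), ∫⁻ z, ‖z.2‖ₑ ^ 2 ∂(Q ε : Measure (Obs X)) ≤ C

variable [∀ t, StandardBorelSpace (X t)] [∀ t, Nonempty (X t)]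

/-- `∫ ∑_{a_t} G dP(x_t | h_{t-1}, a_{t-1})`: integration over the covariates and the treatment
at time `t`. -/
def integrateTime (P : ProbabilityMeasure (Obs X)) (t : Fin T) (G : Traj X → ℝ) (w : Traj X) : ℝ :=
  ∫ x, ∑ b : Bool, G (Function.update w.1 t x, Function.update w.2 t b) ∂(covLaw P t w)

/-- The iterated integral of `F` over covariates and treatments at the times `t + 1, …, T`
(the elements `t, …, T - 1` of `Fin T`), the earliest time outermost. -/
def integrateAfter (P : ProbabilityMeasure (Obs X)) (t : ℕ) (F : Traj X → ℝ) : Traj X → ℝ :=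
  ((List.finRange T).drop t).foldr (integrateTime P) F

/-- The pseudo-regression `m_t(h_t, a_t)` for `t = 0, …, T`, as a function of the trajectory
(it depends on covariates and treatments at the first `t` times only). For `t = T` it is
`outcomeReg`. -/
def pseudoReg (δ : ℝ) (P : ProbabilityMeasure (Obs X)) (t : ℕ) : Traj X → ℝ :=
  integrateAfter P t fun w =>
    outcomeReg P w * ∏ s ∈ Finset.univ.filter (fun s : Fin T => t ≤ (s : ℕ)), intervention δ P s w

/-- The incremental effect `ψ(δ)` as a functional of the distribution of the observations:
`∑_a ∫ μ(h_T, a_T) ∏_t intervention_t dP(x_t | h_{t-1}, a_{t-1})`, which is `m_0`.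
The trajectory at which `m_0` is evaluated is immaterial, see `pseudoReg_zero_eq`. -/
def effect (δ : ℝ) (P : ProbabilityMeasure (Obs X)) : ℝ :=
  pseudoReg δ P 0 (fun t => Classical.arbitrary (X t), fun _ => false)

/-- The explicit function of the observation.
The factor `1 / (δ / (1 - δ))` is written `(1 - δ) / δ`, which also makes sense at `δ = 1`. -/
def eif (δ : ℝ) (P : ProbabilityMeasure (Obs X)) (z : Obs X) : ℝ :=
  ∑ t : Fin T,
      ((ind (z.1.2 t) * (1 - propensity P t z.1)
          - (1 - ind (z.1.2 t)) * δ * propensity P t z.1) * ((1 - δ) / δ)) *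
        ((δ * propensity P t z.1 *
              pseudoReg δ P (t + 1) (z.1.1, Function.update z.1.2 t true)
            + (1 - propensity P t z.1) *
              pseudoReg δ P (t + 1) (z.1.1, Function.update z.1.2 t false)) / denom δ P t z.1) *
        ∏ s ∈ Finset.Iic t, weight δ P s z.1
    + (∏ t : Fin T, weight δ P t z.1) * z.2
    - effect δ P

lemma integrateAfter_congr (P : ProbabilityMeasure (Obs X)) (F : Traj X → ℝ) (n t : ℕ)
    (hn : t + n = T) (w w' : Traj X)
    (h₁ : ∀ s : Fin T, (s : ℕ) < t → w.1 s = w'.1 s)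
    (h₂ : ∀ s : Fin T, (s : ℕ) < t → w.2 s = w'.2 s) :
    integrateAfter P t F w = integrateAfter P t F w' := by
  induction n generalizing t w w' with
  | zero =>
    have : w = w' := Prod.ext (funext fun s => h₁ s (by have := s.2; omega))
      (funext fun s => h₂ s (by have := s.2; omega))
    rw [this]
  | succ n ih =>
    have ht : t < T := by omega
    have hd : integrateAfter P t F = integrateTime P ⟨t, ht⟩ (integrateAfter P (t + 1) F) := by
      unfold integrateAfter
      rw [List.drop_eq_getElem_cons (by simpa using ht), List.foldr_cons]
      simp
    have hp : prev ⟨t, ht⟩ w = prev ⟨t, ht⟩ w' :=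
      Prod.ext (funext fun s => h₁ s s.2) (funext fun s => h₂ s s.2)
    rw [hd]
    unfold integrateTime covLaw
    rw [hp]
    congr 1
    funext x
    refine Finset.sum_congr rfl fun b _ => ih (t + 1) (by omega) _ _ ?_ ?_
    all_goals
      intro s hs
      by_cases hst : s = ⟨t, ht⟩
      · subst hst
        simp
      · have hlt : (s : ℕ) < t := by
          have : (s : ℕ) ≠ t := fun h => hst (Fin.ext h)
          omega
        simp [Function.update_of_ne hst, h₁ s hlt, h₂ s hlt]

lemma pseudoReg_zero_eq (δ : ℝ) (P : ProbabilityMeasure (Obs X)) (w : Traj X) :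
    pseudoReg δ P 0 w = effect δ P :=
  integrateAfter_congr P _ T 0 (by omega) _ _ (by simp) (by simp)

end Incremental

end

namespace Efficiency

section L2

variable {Z : Type*} [MeasurableSpace Z] {ν : Measure Z} {u v : Z → ℝ}

/-- The `L²` seminorm as a real number. -/
noncomputable def l2norm (ν : Measure Z) (u : Z → ℝ) : ℝ := (eLpNorm u 2 ν).toReal

lemma l2norm_nonneg (u : Z → ℝ) : 0 ≤ l2norm ν u := ENNReal.toReal_nonneg

lemma l2norm_add_le (hu : MemLp u 2 ν) (hv : MemLp v 2 ν) :
    l2norm ν (fun z => u z + v z) ≤ l2norm ν u + l2norm ν v := by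
  unfold l2norm
  rw [← ENNReal.toReal_add hu.2.ne hv.2.ne]
  exact ENNReal.toReal_mono (ENNReal.add_ne_top.2 ⟨hu.2.ne, hv.2.ne⟩)
    (eLpNorm_add_le hu.1 hv.1 (by norm_num))

lemma l2norm_const_mul (c : ℝ) (u : Z → ℝ) :
    l2norm ν (fun z => c * u z) = |c| * l2norm ν u := by
  unfold l2norm
  have : (fun z => c * u z) = c • u := rfl
  rw [this, eLpNorm_const_smul, ENNReal.toReal_mul]
  simp

lemma l2norm_le_mul (hv : MemLp v 2 ν) {C : ℝ} (hC : 0 ≤ C) (h : ∀ z, |u z| ≤ C * |v z|) :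
    l2norm ν u ≤ C * l2norm ν v := by
  unfold l2norm
  have h' : ∀ᵐ z ∂ν, ‖u z‖ ≤ C * ‖v z‖ := Eventually.of_forall h
  have := eLpNorm_le_mul_eLpNorm_of_ae_le_mul h' 2
  refine (ENNReal.toReal_mono (ENNReal.mul_ne_top ENNReal.ofReal_ne_top hv.2.ne) this).trans ?_
  rw [ENNReal.toReal_mul, ENNReal.toReal_ofReal hC]

lemma l2norm_mono (hv : MemLp v 2 ν) (h : ∀ z, |u z| ≤ |v z|) : l2norm ν u ≤ l2norm ν v := by
  simpa using l2norm_le_mul hv zero_le_one (by simpa using h)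

lemma memLp_bdd_mul {k : Z → ℝ} (hu : MemLp u 2 ν) (hk : AEStronglyMeasurable k ν) {C : ℝ}
    (hC : ∀ z, |k z| ≤ C) : MemLp (fun z => k z * u z) 2 ν := by
  refine hu.of_le_mul (c := C) (hk.mul hu.1) (Eventually.of_forall fun z => ?_)
  rw [norm_mul]
  exact mul_le_mul_of_nonneg_right (hC z) (norm_nonneg _)

lemma l2norm_bdd_mul {k : Z → ℝ} (hu : MemLp u 2 ν) {C : ℝ} (h0 : 0 ≤ C)
    (hC : ∀ z, |k z| ≤ C) : l2norm ν (fun z => k z * u z) ≤ C * l2norm ν u :=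
  l2norm_le_mul hu h0 fun z => by
    rw [abs_mul]; exact mul_le_mul_of_nonneg_right (hC z) (abs_nonneg _)

lemma l2norm_sq (hu : MemLp u 2 ν) : l2norm ν u ^ 2 = ∫ z, u z * u z ∂ν := by
  have h := hu.integrable_sq
  unfold l2norm
  rw [hu.eLpNorm_eq_integral_rpow_norm (by norm_num) (by norm_num)]
  have h0 : 0 ≤ ∫ z, u z * u z ∂ν := integral_nonneg fun z => mul_self_nonneg _
  have : ∫ a, ‖u a‖ ^ (2 : ℝ≥0∞).toReal ∂ν = ∫ z, u z * u z ∂ν := by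
    congr 1; funext z; simp [sq]
  rw [this, ENNReal.toReal_ofReal (by positivity), ← Real.rpow_natCast, ← Real.rpow_mul h0]
  norm_num

lemma abs_integral_mul_le (hu : MemLp u 2 ν) (hv : MemLp v 2 ν) :
    |∫ z, u z * v z ∂ν| ≤ l2norm ν u * l2norm ν v := by
  have h1 : ‖∫ z, u z * v z ∂ν‖ₑ ≤ eLpNorm u 2 ν * eLpNorm v 2 ν := by
    refine (enorm_integral_le_lintegral_enorm _).trans ?_
    rw [← eLpNorm_one_eq_lintegral_enorm]
    have h := eLpNorm_smul_le_mul_eLpNorm (p := 2) (q := 2) (r := 1) hv.1 hu.1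
    have e : u • v = fun z => u z * v z := rfl
    rwa [e] at h
  have h2 := ENNReal.toReal_mono (ENNReal.mul_ne_top hu.2.ne hv.2.ne) h1
  simpa [l2norm] using h2

lemma integrable_mul_of_memLp (hu : MemLp u 2 ν) (hv : MemLp v 2 ν) :
    Integrable (fun z => u z * v z) ν := hu.integrable_mul hv

variable {ι : Type*} {l : Filter ι}

lemma tendsto_integral_mul_zero {u v : ι → Z → ℝ} (hu : ∀ᶠ i in l, MemLp (u i) 2 ν)
    (hv : ∀ᶠ i in l, MemLp (v i) 2 ν) (hu0 : Tendsto (fun i => l2norm ν (u i)) l (𝓝 0)) {C : ℝ}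
    (hC : ∀ᶠ i in l, l2norm ν (v i) ≤ C) :
    Tendsto (fun i => ∫ z, u i z * v i z ∂ν) l (𝓝 0) := by
  refine squeeze_zero_norm' (a := fun i => l2norm ν (u i) * C) ?_ (by simpa using hu0.mul_const C)
  filter_upwards [hu, hv, hC] with i h1 h2 h3
  exact (abs_integral_mul_le h1 h2).trans (mul_le_mul_of_nonneg_left h3 (l2norm_nonneg _))

/-- Convergence in `L²`. -/
def L2Tendsto (ν : Measure Z) (l : Filter ι) (u : ι → Z → ℝ) (u₀ : Z → ℝ) : Prop :=
  Tendsto (fun i => l2norm ν (fun z => u i z - u₀ z)) l (𝓝 0)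

lemma L2Tendsto.congr' {u v : ι → Z → ℝ} {u₀ v₀ : Z → ℝ} (h : L2Tendsto ν l u u₀)
    (huv : ∀ᶠ i in l, ∀ z, u i z - u₀ z = v i z - v₀ z) : L2Tendsto ν l v v₀ :=
  Tendsto.congr' (huv.mono fun i hi => by simp only [hi]) h

lemma L2Tendsto.of_abs_le {u v : ι → Z → ℝ} {u₀ v₀ : Z → ℝ} (h : L2Tendsto ν l u u₀)
    (hu : ∀ᶠ i in l, MemLp (u i) 2 ν) (hu₀ : MemLp u₀ 2 ν)
    (huv : ∀ᶠ i in l, ∀ z, |v i z - v₀ z| ≤ |u i z - u₀ z|) : L2Tendsto ν l v v₀ := by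
  refine squeeze_zero' (Eventually.of_forall fun i => l2norm_nonneg _) ?_ h
  filter_upwards [hu, huv] with i h1 h2
  exact l2norm_mono (h1.sub hu₀) h2

lemma L2Tendsto.add {u v : ι → Z → ℝ} {u₀ v₀ : Z → ℝ} (hu : L2Tendsto ν l u u₀)
    (hv : L2Tendsto ν l v v₀) (hum : ∀ᶠ i in l, MemLp (u i) 2 ν) (hvm : ∀ᶠ i in l, MemLp (v i) 2 ν)
    (hu₀ : MemLp u₀ 2 ν) (hv₀ : MemLp v₀ 2 ν) :
    L2Tendsto ν l (fun i z => u i z + v i z) (fun z => u₀ z + v₀ z) := by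
  have := Tendsto.add hu hv
  rw [add_zero] at this
  refine squeeze_zero' (Eventually.of_forall fun i => l2norm_nonneg _) ?_ this
  filter_upwards [hum, hvm] with i h1 h2
  have := l2norm_add_le (h1.sub hu₀) (h2.sub hv₀)
  refine le_trans (le_of_eq ?_) this
  congr 1; funext z; simp; ring

lemma L2Tendsto.eventually_le {u : ι → Z → ℝ} {u₀ : Z → ℝ} (hu : L2Tendsto ν l u u₀)
    (hum : ∀ᶠ i in l, MemLp (u i) 2 ν) (hu₀ : MemLp u₀ 2 ν) :
    ∀ᶠ i in l, l2norm ν (u i) ≤ 1 + l2norm ν u₀ := by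
  filter_upwards [hum, hu.eventually_le_const (u := 1) (by norm_num)] with i h1 h2
  have := l2norm_add_le (h1.sub hu₀) hu₀
  simp only [Pi.sub_apply, sub_add_cancel] at this
  have h3 : (u i - u₀) = fun z => u i z - u₀ z := rfl
  rw [h3] at this
  linarith

/-- Bounded multipliers that converge appropriately preserve `L²` convergence. -/
lemma L2Tendsto.bdd_mul {k u : ι → Z → ℝ} {k₀ u₀ : Z → ℝ} (hu : L2Tendsto ν l u u₀)
    (hum : ∀ᶠ i in l, MemLp (u i) 2 ν) (hu₀ : MemLp u₀ 2 ν)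
    (hkm : ∀ i, AEStronglyMeasurable (k i) ν) (hk₀ : AEStronglyMeasurable k₀ ν) {C : ℝ} (hC : 0 ≤ C)
    (hk : ∀ᶠ i in l, ∀ z, |k i z| ≤ C) (hk₀C : ∀ z, |k₀ z| ≤ C)
    (hku : L2Tendsto ν l (fun i z => k i z * u₀ z) (fun z => k₀ z * u₀ z)) :
    L2Tendsto ν l (fun i z => k i z * u i z) (fun z => k₀ z * u₀ z) := by
  have := (Tendsto.const_mul C hu).add hku
  rw [mul_zero, add_zero] at this
  refine squeeze_zero' (Eventually.of_forall fun i => l2norm_nonneg _) ?_ this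
  filter_upwards [hum, hk] with i h1 h2
  have h3 : MemLp (fun z => u i z - u₀ z) 2 ν := h1.sub hu₀
  have h4 : MemLp (fun z => k i z * u₀ z - k₀ z * u₀ z) 2 ν :=
    (memLp_bdd_mul hu₀ (hkm i) h2).sub (memLp_bdd_mul hu₀ hk₀ hk₀C)
  have h5 := l2norm_add_le (memLp_bdd_mul h3 (hkm i) h2) h4
  have h6 := l2norm_bdd_mul h3 hC h2
  refine le_trans (le_of_eq ?_) (h5.trans (add_le_add_left h6 _))
  congr 1; funext z; ring

lemma tendsto_integral_mul {u v : ι → Z → ℝ} {u₀ : Z → ℝ} {c : ℝ} (hu : L2Tendsto ν l u u₀)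
    (hum : ∀ᶠ i in l, MemLp (u i) 2 ν) (hu₀ : MemLp u₀ 2 ν)
    (hvm : ∀ᶠ i in l, MemLp (v i) 2 ν) {C : ℝ} (hC : ∀ᶠ i in l, l2norm ν (v i) ≤ C)
    (hw : Tendsto (fun i => ∫ z, u₀ z * v i z ∂ν) l (𝓝 c)) :
    Tendsto (fun i => ∫ z, u i z * v i z ∂ν) l (𝓝 c) := by
  have h := tendsto_integral_mul_zero (u := fun i z => u i z - u₀ z)
    (hum.mono fun i hi => hi.sub hu₀) hvm hu hC
  have := h.add hw
  rw [zero_add] at this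
  refine this.congr' ?_
  filter_upwards [hum, hvm] with i h1 h2
  have h3 : MemLp (fun z => u i z - u₀ z) 2 ν := h1.sub hu₀
  rw [← integral_add (integrable_mul_of_memLp h3 h2) (integrable_mul_of_memLp hu₀ h2)]
  congr 1; funext z; ring

/-- The part of a square-integrable function where `Y` is large vanishes in the limit. -/
lemma l2Tendsto_trunc [l.IsCountablyGenerated] {h Y : Z → ℝ} (hh : MemLp h 2 ν)
    (hY : Measurable Y) {c : ι → ℝ} (hc : Tendsto c l atTop) :
    L2Tendsto ν l (fun i z => if |Y z| ≤ c i then h z else 0) h := by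
  have hm : ∀ i, MemLp (fun z => if |Y z| ≤ c i then h z else 0) 2 ν := fun i => by
    have : MeasurableSet {z | |Y z| ≤ c i} := measurableSet_le hY.abs measurable_const
    exact hh.indicator this
  have key : Tendsto (fun i => ∫ z, ((if |Y z| ≤ c i then h z else 0) - h z) *
      ((if |Y z| ≤ c i then h z else 0) - h z) ∂ν) l (𝓝 (∫ _, 0 ∂ν)) := by
    refine tendsto_integral_filter_of_dominated_convergence (fun z => h z ^ 2) ?_ ?_
      hh.integrable_sq ?_
    · exact Eventually.of_forall fun i => (integrable_mul_of_memLp ((hm i).sub hh)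
        ((hm i).sub hh)).1
    · refine Eventually.of_forall fun i => Eventually.of_forall fun z => ?_
      split_ifs
      · simp; positivity
      · simp [sq]
    · refine Eventually.of_forall fun z => ?_
      refine tendsto_const_nhds.congr' ?_
      filter_upwards [hc.eventually_ge_atTop |Y z|] with i hi
      simp [hi]
  have h2 := key.sqrt
  simp only [integral_zero, Real.sqrt_zero] at h2
  refine h2.congr fun i => ?_
  have := l2norm_sq ((hm i).sub hh)
  simp only [Pi.sub_apply] at this
  rw [← this, Real.sqrt_sq (l2norm_nonneg _)]
  rfl

/-- Uniformly bounded multipliers `k i` with `k i * r → 0` in `L²` also satisfy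
`k i * h → 0` for every `h = f * r` in `L²`. -/
lemma l2Tendsto_bdd_mul_zero {k : ι → Z → ℝ} {f r : Z → ℝ} (hf : Measurable f)
    (hr : MemLp r 2 ν)
    (hfr : MemLp (fun z => f z * r z) 2 ν) (hkm : ∀ i, AEStronglyMeasurable (k i) ν) {C : ℝ}
    (hC : 0 ≤ C) (hk : ∀ᶠ i in l, ∀ z, |k i z| ≤ C)
    (hkr : L2Tendsto ν l (fun i z => k i z * r z) 0) :
    L2Tendsto ν l (fun i z => k i z * (f z * r z)) 0 := by
  unfold L2Tendsto at hkr ⊢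
  simp only [Pi.zero_apply, sub_zero] at hkr ⊢
  rw [Metric.tendsto_nhds]
  intro η hη
  have ht := l2Tendsto_trunc hfr hf (tendsto_natCast_atTop_atTop (R := ℝ))
  obtain ⟨n, hn⟩ := (ht.eventually_lt_const (u := η / (2 * (C + 1))) (by positivity)).exists
  have h1 := (Tendsto.const_mul (n : ℝ) hkr).eventually_lt_const (u := η / 2)
    (by simpa using by positivity)
  filter_upwards [h1, hk] with i h2 h3
  simp only [dist_zero_right, Real.norm_eq_abs, abs_of_nonneg (l2norm_nonneg _)]
  have hset : MeasurableSet {z | |f z| ≤ (n : ℝ)} := measurableSet_le hf.abs measurable_const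
  have m1 : MemLp (fun z => if |f z| ≤ (n : ℝ) then f z * r z else 0) 2 ν := hfr.indicator hset
  have m2 : MemLp (fun z => k i z * if |f z| ≤ (n : ℝ) then f z * r z else 0) 2 ν :=
    memLp_bdd_mul m1 (hkm i) h3
  have m0 : MemLp (fun z => (if |f z| ≤ (n : ℝ) then f z * r z else 0) - f z * r z) 2 ν :=
    m1.sub hfr
  have m3 : MemLp (fun z => -k i z * ((if |f z| ≤ (n : ℝ) then f z * r z else 0) - f z * r z))
      2 ν := memLp_bdd_mul m0 (hkm i).neg (by simpa using h3)
  have e1 := l2norm_add_le m2 m3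
  have e2 : l2norm ν (fun z => k i z * if |f z| ≤ (n : ℝ) then f z * r z else 0)
      ≤ n * l2norm ν (fun z => k i z * r z) :=
    l2norm_le_mul (memLp_bdd_mul hr (hkm i) h3) (by positivity) fun z => by
      split_ifs with hz
      · rw [abs_mul, abs_mul, abs_mul]
        have := mul_nonneg (abs_nonneg (k i z)) (abs_nonneg (r z))
        nlinarith
      · simp; positivity
  have e3 := l2norm_bdd_mul (k := fun z => -k i z) m0 hC (by simpa using h3)
  have e4 : C * l2norm ν (fun z => (if |f z| ≤ (n : ℝ) then f z * r z else 0) - f z * r z)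
      ≤ η / 2 := by
    calc _ ≤ (C + 1) * (η / (2 * (C + 1))) :=
          mul_le_mul (by linarith) hn.le (l2norm_nonneg _) (by linarith)
      _ = η / 2 := by field_simp
  have e5 : (fun z => k i z * (f z * r z)) =
      fun z => (k i z * if |f z| ≤ (n : ℝ) then f z * r z else 0) +
        -k i z * ((if |f z| ≤ (n : ℝ) then f z * r z else 0) - f z * r z) := by
    funext z; ring
  rw [e5]
  linarith

end L2

end Efficiency

namespace Efficiency

section RootModel

variable {Z : Type*} [mZ : MeasurableSpace Z]

/-- Orthogonality of bounded `m`-measurable functions to the residual of a conditional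
expectation. -/
lemma integral_mul_condExp {Q : Measure Z} [IsFiniteMeasure Q] {m : MeasurableSpace Z}
    (hm : m ≤ mZ) {f u : Z → ℝ} (hf : StronglyMeasurable[m] f) (hu : Integrable u Q) {C : ℝ}
    (hC : ∀ z, |f z| ≤ C) : ∫ z, f z * (Q[u | m]) z ∂Q = ∫ z, f z * u z ∂Q := by
  have h1 := condExp_stronglyMeasurable_mul_of_bound hm hf hu C (Eventually.of_forall hC)
  calc _ = ∫ z, (Q[f * u | m]) z ∂Q := integral_congr_ae h1.symm
    _ = ∫ z, (f * u) z ∂Q := integral_condExp hm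
    _ = _ := rfl

/-- A one-dimensional family of distributions represented by square roots `r ε` of densities with
respect to `ν`, differentiable in quadratic mean at `0` with the measurable score `g`. -/
structure RootModel (ν : Measure Z) (r : ℝ → Z → ℝ) (Q : ℝ → ProbabilityMeasure Z)
    (g : Z → ℝ) : Prop where
  measurable_root : ∀ ε, Measurable (r ε)
  integral_eq : ∀ ε (f : Z → ℝ),
    ∫ z, f z ∂(Q ε : Measure Z) = ∫ z, f z * (r ε z * r ε z) ∂ν
  eLpNorm_eq : ∀ ε (f : Z → ℝ), Measurable f →
    eLpNorm f 2 (Q ε : Measure Z) = eLpNorm (fun z => f z * r ε z) 2 ν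
  measurable_score : Measurable g
  memLp_score : MemLp g 2 (Q 0 : Measure Z)
  tendsto : L2Tendsto ν (𝓝[≠] 0) (fun ε z => (r ε z - r 0 z) / ε) (fun z => g z / 2 * r 0 z)

lemma IsSubmodel.exists_rootModel {P : ProbabilityMeasure Z} {Q : ℝ → ProbabilityMeasure Z}
    {g : Z → ℝ} (h : IsSubmodel P Q g) :
    ∃ (ν : Measure Z) (r : ℝ → Z → ℝ) (g' : Z → ℝ), g =ᵐ[(P : Measure Z)] g' ∧
      RootModel ν r Q g' := by
  obtain ⟨ν, hν, hac, ht⟩ := h.qmd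
  have hb := h.base
  subst hb
  have hg := h.score_memLp
  have hsq : ∀ ε z, √(density (Q ε) ν z) * √(density (Q ε) ν z) = density (Q ε) ν z :=
    fun ε z => Real.mul_self_sqrt ENNReal.toReal_nonneg
  have hdm : ∀ ε, Measurable (density (Q ε) ν) := fun ε =>
    (Measure.measurable_rnDeriv _ _).ennreal_toReal
  refine ⟨ν, fun ε z => √(density (Q ε) ν z), hg.1.mk g, hg.1.ae_eq_mk, ?_, ?_, ?_, ?_, ?_, ?_⟩
  · exact fun ε => (hdm ε).sqrt
  · intro ε f
    rw [← integral_toReal_rnDeriv_mul (hac ε)]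
    congr 1; funext z
    rw [hsq, mul_comm]; rfl
  · intro ε f hf
    rw [eLpNorm_eq_lintegral_rpow_enorm_toReal (by norm_num) (by norm_num),
      eLpNorm_eq_lintegral_rpow_enorm_toReal (by norm_num) (by norm_num),
      ← lintegral_rnDeriv_mul (hac ε) (by fun_prop)]
    congr 1
    refine lintegral_congr_ae ?_
    filter_upwards [Measure.rnDeriv_lt_top (Q ε : Measure Z) ν] with z hz
    have : ((Q ε : Measure Z).rnDeriv ν z) = ‖√(density (Q ε) ν z)‖ₑ ^ (2 : ℝ≥0∞).toReal := by
      have h2 : (2 : ℝ≥0∞).toReal = ((2 : ℕ) : ℝ) := by norm_num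
      rw [h2, ENNReal.rpow_natCast, sq, ← enorm_mul, hsq,
        density, Real.enorm_of_nonneg ENNReal.toReal_nonneg, ENNReal.ofReal_toReal hz.ne]
    rw [enorm_mul, ENNReal.mul_rpow_of_nonneg _ _ (by norm_num), ← this, mul_comm]
  · exact hg.1.stronglyMeasurable_mk.measurable
  · exact hg.ae_eq hg.1.ae_eq_mk
  · have hae : ∀ᵐ z ∂ν, g z * √(density (Q 0) ν z) = hg.1.mk g z * √(density (Q 0) ν z) := by
      have h1 := hg.1.ae_eq_mk
      generalize hg.1.mk g = g' at h1
      rw [EventuallyEq, ← Measure.withDensity_rnDeriv_eq _ _ (hac 0),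
        ae_withDensity_iff (Measure.measurable_rnDeriv _ _)] at h1
      filter_upwards [h1] with z hz
      by_cases h0 : (Q 0 : Measure Z).rnDeriv ν z = 0
      · simp [density, h0]
      · rw [hz h0]
    have := (ENNReal.tendsto_toReal ENNReal.zero_ne_top).comp ht
    refine this.congr fun ε => ?_
    simp only [Function.comp, l2norm]
    congr 1
    refine eLpNorm_congr_ae ?_
    filter_upwards [hae] with z hz
    linear_combination - hz / 2

namespace RootModel

variable {ν : Measure Z} {r : ℝ → Z → ℝ} {Q : ℝ → ProbabilityMeasure Z} {g : Z → ℝ}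

lemma memLp_mul_iff (M : RootModel ν r Q g) {ε : ℝ} {f : Z → ℝ} (hf : Measurable f) :
    MemLp (fun z => f z * r ε z) 2 ν ↔ MemLp f 2 (Q ε : Measure Z) := by
  have := M.eLpNorm_eq ε f hf
  refine ⟨fun h => ⟨hf.aestronglyMeasurable, this ▸ h.2⟩,
    fun h => ⟨(hf.mul (M.measurable_root ε)).aestronglyMeasurable, this ▸ h.2⟩⟩

lemma memLp_root (M : RootModel ν r Q g) (ε : ℝ) : MemLp (r ε) 2 ν := by
  simpa using (M.memLp_mul_iff (ε := ε) (f := fun _ => 1) measurable_const).2 (memLp_const 1)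

lemma memLp_score_mul (M : RootModel ν r Q g) : MemLp (fun z => g z / 2 * r 0 z) 2 ν := by
  rw [M.memLp_mul_iff (M.measurable_score.div_const 2)]
  have := M.memLp_score.const_mul (1 / 2)
  exact this.ae_eq (Eventually.of_forall fun z => by ring)

lemma memLp_quot (M : RootModel ν r Q g) (ε : ℝ) : MemLp (fun z => (r ε z - r 0 z) / ε) 2 ν := by
  have := ((M.memLp_root ε).sub (M.memLp_root 0)).const_mul ε⁻¹
  exact this.ae_eq (Eventually.of_forall fun z => by simp; ring)

lemma l2Tendsto_root (M : RootModel ν r Q g) : L2Tendsto ν (𝓝[≠] 0) r (r 0) := by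
  have hb := M.tendsto.eventually_le (Eventually.of_forall M.memLp_quot) M.memLp_score_mul
  have hid : Tendsto (fun ε : ℝ => |ε| * (1 + l2norm ν (fun z => g z / 2 * r 0 z)))
      (𝓝[≠] 0) (𝓝 0) := by
    have : Tendsto (fun ε : ℝ => |ε| * (1 + l2norm ν (fun z => g z / 2 * r 0 z))) (𝓝 0)
        (𝓝 (|0| * (1 + l2norm ν (fun z => g z / 2 * r 0 z)))) := by
      exact (continuous_abs.tendsto 0).mul_const _
    simp only [abs_zero, zero_mul] at this
    exact this.mono_left nhdsWithin_le_nhds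
  refine squeeze_zero' (Eventually.of_forall fun i => l2norm_nonneg _) ?_ hid
  filter_upwards [hb, self_mem_nhdsWithin] with ε h1 h2
  refine le_trans (le_of_eq ?_) (mul_le_mul_of_nonneg_left h1 (abs_nonneg ε))
  rw [← l2norm_const_mul]
  congr 1; funext z; field_simp [show ε ≠ 0 from h2]

/-- If `ε * f ε` is uniformly bounded and `f ε` is bounded in `L²(Q 0)`, then
`f ε * (r ε - r 0)` tends to `0` in `L²`. -/
lemma l2Tendsto_mul_root_sub (M : RootModel ν r Q g) {f : ℝ → Z → ℝ} (hf : ∀ ε, Measurable (f ε))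
    {C C' : ℝ} (hC : 0 ≤ C) (hfC : ∀ᶠ ε in 𝓝[≠] 0, ∀ z, |ε * f ε z| ≤ C)
    (hf0 : ∀ᶠ ε in 𝓝[≠] 0, l2norm ν (fun z => f ε z * r 0 z) ≤ C') :
    L2Tendsto ν (𝓝[≠] 0) (fun ε z => f ε z * (r ε z - r 0 z)) 0 := by
  have hkm : ∀ ε, AEStronglyMeasurable (fun z => ε * f ε z) ν := fun ε =>
    ((hf ε).const_mul ε).aestronglyMeasurable
  have h0 : L2Tendsto ν (𝓝[≠] 0) (fun ε z => (ε * f ε z) * r 0 z) 0 := by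
    have hid : Tendsto (fun ε : ℝ => |ε| * C') (𝓝[≠] 0) (𝓝 0) := by
      have : Tendsto (fun ε : ℝ => |ε| * C') (𝓝 0) (𝓝 (|0| * C')) :=
        (continuous_abs.tendsto 0).mul_const _
      simp only [abs_zero, zero_mul] at this
      exact this.mono_left nhdsWithin_le_nhds
    refine squeeze_zero' (Eventually.of_forall fun i => l2norm_nonneg _) ?_ hid
    filter_upwards [hf0] with ε h1
    refine le_trans (le_of_eq ?_) (mul_le_mul_of_nonneg_left h1 (abs_nonneg ε))
    rw [← l2norm_const_mul]
    congr 1; funext z; simp; ring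
  have h1 := l2Tendsto_bdd_mul_zero (M.measurable_score.div_const 2) (M.memLp_root 0)
    M.memLp_score_mul hkm hC hfC h0
  have h2 := M.tendsto.bdd_mul (k := fun ε z => ε * f ε z) (k₀ := 0)
    (Eventually.of_forall M.memLp_quot) M.memLp_score_mul hkm
    aestronglyMeasurable_const hC hfC (by simpa using fun _ => hC) (by simpa [Pi.zero_def] using h1)
  refine h2.congr' ?_
  filter_upwards [self_mem_nhdsWithin] with ε h2 z
  field_simp [show ε ≠ 0 from h2]
  simp [mul_comm]

/-- Multipliers that converge boundedly along the model converge against every element of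
`L²(Q 0)`. -/
lemma l2Tendsto_mul_of_bdd (M : RootModel ν r Q g) {k : ℝ → Z → ℝ} {k₀ f : Z → ℝ}
    (hk : ∀ ε, Measurable (k ε)) (hk₀ : Measurable k₀) {C : ℝ} (hC : 0 ≤ C)
    (hkC : ∀ ε z, |k ε z| ≤ C) (hkC₀ : ∀ z, |k₀ z| ≤ C)
    (h : L2Tendsto ν (𝓝[≠] 0) (fun ε z => (k ε z - k₀ z) * r ε z) 0)
    (hf : Measurable f) (hfm : MemLp (fun z => f z * r 0 z) 2 ν) :
    L2Tendsto ν (𝓝[≠] 0) (fun ε z => k ε z * (f z * r 0 z)) (fun z => k₀ z * (f z * r 0 z)) := by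
  have hb : ∀ ε z, |k ε z - k₀ z| ≤ 2 * C := fun ε z => by
    have := abs_sub (k ε z) (k₀ z); linarith [hkC ε z, hkC₀ z]
  have hkm : ∀ ε, AEStronglyMeasurable (fun z => k ε z - k₀ z) ν := fun ε =>
    ((hk ε).sub hk₀).aestronglyMeasurable
  have h1 : L2Tendsto ν (𝓝[≠] 0) (fun ε z => (k ε z - k₀ z) * (r ε z - r 0 z)) 0 := by
    have := (M.l2Tendsto_root.const_mul (2 * C))
    rw [mul_zero] at this
    refine squeeze_zero (fun i => l2norm_nonneg _) (fun ε => ?_) this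
    have := l2norm_bdd_mul (k := fun z => k ε z - k₀ z) (u := fun z => r ε z - r 0 z)
      ((M.memLp_root ε).sub (M.memLp_root 0)) (by positivity) (hb ε)
    simpa only [Pi.sub_apply, Pi.zero_apply, sub_zero] using this
  have h2 : L2Tendsto ν (𝓝[≠] 0) (fun ε z => (k ε z - k₀ z) * r 0 z) 0 := by
    have h1' : L2Tendsto ν (𝓝[≠] 0) (fun ε z => -((k ε z - k₀ z) * (r ε z - r 0 z))) 0 :=
      h1.of_abs_le (Eventually.of_forall fun ε => memLp_bdd_mul
        ((M.memLp_root ε).sub (M.memLp_root 0)) (hkm ε) (hb ε)) MemLp.zero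
        (Eventually.of_forall fun ε z => by simp)
    refine (h.add h1' (Eventually.of_forall fun ε => memLp_bdd_mul (M.memLp_root ε) (hkm ε) (hb ε))
      (Eventually.of_forall fun ε => (memLp_bdd_mul
        ((M.memLp_root ε).sub (M.memLp_root 0)) (hkm ε) (hb ε)).neg) MemLp.zero MemLp.zero).congr'
      (Eventually.of_forall fun ε z => ?_)
    simp; ring
  refine (l2Tendsto_bdd_mul_zero hf (M.memLp_root 0) hfm hkm (by positivity)
    (Eventually.of_forall hb) h2).congr' (Eventually.of_forall fun ε z => ?_)
  simp; ring

end RootModel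

end RootModel

end Efficiency

namespace Efficiency

namespace RootModel

section CondExpDerivative

variable {Z : Type*} {m : MeasurableSpace Z} [mZ : MeasurableSpace Z] {ν : Measure Z} {r : ℝ → Z → ℝ}
  {Q : ℝ → ProbabilityMeasure Z} {g : Z → ℝ} {A : Z → ℝ} {p : ℝ → Z → ℝ}

lemma integral_residual_mul (M : RootModel ν r Q g) (hm : m ≤ mZ) (hA : Measurable A)
    (hA01 : ∀ z, A z ∈ Set.Icc (0 : ℝ) 1)
    (hpA : ∀ ε, (Q ε : Measure Z)[A | m] =ᵐ[(Q ε : Measure Z)] p ε)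
    {f : Z → ℝ} (hf : StronglyMeasurable[m] f) {C : ℝ} (hC : ∀ z, |f z| ≤ C) (ε : ℝ)
    (hp : Measurable (p ε)) (hp01 : ∀ z, p ε z ∈ Set.Icc (0 : ℝ) 1) :
    ∫ z, ((A z - p ε z) * r ε z) * (f z * r ε z) ∂ν = 0 := by
  have hAi : Integrable A (Q ε : Measure Z) := Integrable.of_bound hA.aestronglyMeasurable 1
    (Eventually.of_forall fun z => by
      rw [Real.norm_eq_abs, abs_le]; exact ⟨by linarith [(hA01 z).1], (hA01 z).2⟩)
  have hpi : Integrable (p ε) (Q ε : Measure Z) := Integrable.of_bound hp.aestronglyMeasurable 1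
    (Eventually.of_forall fun z => by
      rw [Real.norm_eq_abs, abs_le]; exact ⟨by linarith [(hp01 z).1], (hp01 z).2⟩)
  have h1 := integral_mul_condExp hm hf hAi hC
  have h2 : ∫ z, f z * ((Q ε : Measure Z)[A | m]) z ∂(Q ε : Measure Z)
      = ∫ z, f z * p ε z ∂(Q ε : Measure Z) := by
    refine integral_congr_ae ?_
    filter_upwards [hpA ε] with z hz
    rw [hz]
  have hfm := (hf.mono hm).aestronglyMeasurable (μ := (Q ε : Measure Z))
  have h3 : ∫ z, (A z - p ε z) * f z ∂(Q ε : Measure Z) = 0 := by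
    have i1 : Integrable (fun z => f z * A z) (Q ε : Measure Z) :=
      hAi.bdd_mul hfm (Eventually.of_forall hC)
    have i2 : Integrable (fun z => f z * p ε z) (Q ε : Measure Z) :=
      hpi.bdd_mul hfm (Eventually.of_forall hC)
    have : (fun z => (A z - p ε z) * f z) = fun z => f z * A z - f z * p ε z := by
      funext z; ring
    rw [this, integral_sub i1 i2, ← h1, h2, sub_self]
  rw [M.integral_eq] at h3
  rw [← h3]
  congr 1; funext z; ring

/-- The difference quotient of conditional expectations, tested against bounded conditioning
functions, in terms of the difference quotient of the root densities. -/
lemma integral_quot_mul (M : RootModel ν r Q g) (hm : m ≤ mZ) (hA : Measurable A)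
    (hA01 : ∀ z, A z ∈ Set.Icc (0 : ℝ) 1)
    (hpA : ∀ ε, (Q ε : Measure Z)[A | m] =ᵐ[(Q ε : Measure Z)] p ε)
    (hp : ∀ ε, StronglyMeasurable[m] (p ε)) (hp01 : ∀ ε z, p ε z ∈ Set.Icc (0 : ℝ) 1)
    {f : Z → ℝ} (hf : StronglyMeasurable[m] f) {C : ℝ} (hC : ∀ z, |f z| ≤ C) {ε : ℝ} (hε : ε ≠ 0) :
    ∫ z, ((p ε z - p 0 z) / ε * r ε z) * (f z * r ε z) ∂ν =
      ∫ z, ((A z - p 0 z) * ((r ε z - r 0 z) / ε)) * (f z * r ε z + f z * r 0 z) ∂ν := by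
  have hpm : ∀ ε, Measurable (p ε) := fun ε => ((hp ε).mono hm).measurable
  have hfm : AEStronglyMeasurable f ν := (hf.mono hm).aestronglyMeasurable
  have hres : ∀ ε z, |A z - p ε z| ≤ 1 := fun ε z => by
    rw [abs_le]; constructor <;> linarith [(hA01 z).1, (hA01 z).2, (hp01 ε z).1, (hp01 ε z).2]
  have hpd : ∀ z, |p ε z - p 0 z| ≤ 1 := fun z => by
    rw [abs_le]; constructor <;>
      linarith [(hp01 0 z).1, (hp01 0 z).2, (hp01 ε z).1, (hp01 ε z).2]
  have a1 := M.integral_residual_mul hm hA hA01 hpA hf hC ε (hpm ε) (hp01 ε)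
  have a2 := M.integral_residual_mul hm hA hA01 hpA hf hC 0 (hpm 0) (hp01 0)
  have mr : ∀ ε, MemLp (fun z => f z * r ε z) 2 ν := fun ε => memLp_bdd_mul (M.memLp_root ε) hfm hC
  have mA : ∀ ε, MemLp (fun z => (A z - p ε z) * r ε z) 2 ν := fun ε =>
    memLp_bdd_mul (M.memLp_root ε) (hA.sub (hpm ε)).aestronglyMeasurable (hres ε)
  have mp : MemLp (fun z => (p ε z - p 0 z) / ε * r ε z) 2 ν := by
    have := (memLp_bdd_mul (M.memLp_root ε)
      ((hpm ε).sub (hpm 0)).aestronglyMeasurable hpd).const_mul ε⁻¹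
    exact this.ae_eq (Eventually.of_forall fun z => by simp only [Pi.sub_apply]; ring)
  have mD : MemLp (fun z => (A z - p 0 z) * ((r ε z - r 0 z) / ε)) 2 ν :=
    memLp_bdd_mul (M.memLp_quot ε) (hA.sub (hpm 0)).aestronglyMeasurable (hres 0)
  have i1 := integrable_mul_of_memLp mp (mr ε)
  have i2 := integrable_mul_of_memLp mD ((mr ε).add (mr 0))
  simp only [Pi.add_apply] at i2
  have i3 := integrable_mul_of_memLp (mA ε) (mr ε)
  have i4 := integrable_mul_of_memLp (mA 0) (mr 0)
  rw [← sub_eq_zero, ← integral_sub i1 i2]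
  have e : ∀ z, ((p ε z - p 0 z) / ε * r ε z) * (f z * r ε z) -
      ((A z - p 0 z) * ((r ε z - r 0 z) / ε)) * (f z * r ε z + f z * r 0 z) =
      ε⁻¹ * (((A z - p 0 z) * r 0 z) * (f z * r 0 z) - ((A z - p ε z) * r ε z) * (f z * r ε z)) := by
    intro z; field_simp; ring
  calc _ = ∫ z, ε⁻¹ * (((A z - p 0 z) * r 0 z) * (f z * r 0 z)
        - ((A z - p ε z) * r ε z) * (f z * r ε z)) ∂ν := by
        congr 1; funext z; exact e z
    _ = 0 := by rw [integral_const_mul, integral_sub i4 i3, a1, a2]; simp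

/-- Conditional expectations of a bounded variable given a sub-σ-algebra are differentiable in
quadratic mean along the model, the derivative being the conditional covariance with the score. -/
theorem l2Tendsto_condExp_quot (M : RootModel ν r Q g) (hm : m ≤ mZ) (hA : Measurable A)
    (hA01 : ∀ z, A z ∈ Set.Icc (0 : ℝ) 1)
    (hpA : ∀ ε, (Q ε : Measure Z)[A | m] =ᵐ[(Q ε : Measure Z)] p ε)
    (hp : ∀ ε, StronglyMeasurable[m] (p ε)) (hp01 : ∀ ε z, p ε z ∈ Set.Icc (0 : ℝ) 1) :
    L2Tendsto ν (𝓝[≠] 0) (fun ε z => (p ε z - p 0 z) / ε * r ε z)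
      (fun z => ((Q 0 : Measure Z)[fun z => (A z - p 0 z) * g z | m]) z * r 0 z) := by
  set Δ : ℝ → Z → ℝ := fun ε z => (p ε z - p 0 z) / ε with hΔ
  set Δ₀ : Z → ℝ := (Q 0 : Measure Z)[fun z => (A z - p 0 z) * g z | m] with hΔ₀
  set D : ℝ → Z → ℝ := fun ε z => (r ε z - r 0 z) / ε with hD
  set B : Z → ℝ := fun z => A z - p 0 z with hB
  have hpm : ∀ ε, Measurable (p ε) := fun ε => ((hp ε).mono hm).measurable
  have hBm : Measurable B := hA.sub (hpm 0)
  have hB1 : ∀ z, |B z| ≤ 1 := fun z => by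
    rw [abs_le]; constructor <;> simp only [hB] <;>
      linarith [(hA01 z).1, (hA01 z).2, (hp01 0 z).1, (hp01 0 z).2]
  have hΔsm : ∀ ε, StronglyMeasurable[m] (Δ ε) := fun ε => 
    (((hp ε).measurable.sub (hp 0).measurable).div_const ε).stronglyMeasurable
  have hΔm : ∀ ε, Measurable (Δ ε) := fun ε => ((hΔsm ε).mono hm).measurable
  have hΔ₀sm : StronglyMeasurable[m] Δ₀ := stronglyMeasurable_condExp
  have hΔ₀m : Measurable Δ₀ := (hΔ₀sm.mono hm).measurable
  have hpd : ∀ ε z, |p ε z - p 0 z| ≤ 1 := fun ε z => by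
    rw [abs_le]; constructor <;>
      linarith [(hp01 0 z).1, (hp01 0 z).2, (hp01 ε z).1, (hp01 ε z).2]
  have hΔC : ∀ ε z, |Δ ε z| ≤ |ε|⁻¹ := fun ε z => by
    simp only [hΔ]
    rw [abs_div, div_eq_mul_inv]
    exact mul_le_of_le_one_left (by positivity) (hpd ε z)
  have hne : ∀ᶠ ε : ℝ in 𝓝[≠] 0, ε ≠ 0 := self_mem_nhdsWithin
  have mD : ∀ ε, MemLp (D ε) 2 ν := M.memLp_quot
  have hDb := M.tendsto.eventually_le (Eventually.of_forall mD) M.memLp_score_mul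
  set K : ℝ := 1 + l2norm ν (fun z => g z / 2 * r 0 z)
  have mΔ : ∀ ε ε', MemLp (fun z => Δ ε z * r ε' z) 2 ν := fun ε ε' =>
    memLp_bdd_mul (M.memLp_root ε') (hΔm ε).aestronglyMeasurable (hΔC ε)
  have mΔ₀ : MemLp (fun z => Δ₀ z * r 0 z) 2 ν := by
    rw [M.memLp_mul_iff hΔ₀m]
    exact MemLp.condExp (by norm_num)
      (memLp_bdd_mul M.memLp_score hBm.aestronglyMeasurable hB1)
  -- boundedness of the difference quotients
  have hbound : ∀ᶠ ε in 𝓝[≠] 0, l2norm ν (fun z => Δ ε z * r ε z) ≤ 3 * K ∧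
      l2norm ν (fun z => Δ ε z * r 0 z) ≤ 4 * K := by
    filter_upwards [hne, hDb] with ε hε hDK
    have e0 : l2norm ν (fun z => Δ ε z * r 0 z) ≤
        l2norm ν (fun z => Δ ε z * r ε z) + l2norm ν (D ε) := by
      have m2 : MemLp (fun z => -(ε * Δ ε z) * D ε z) 2 ν :=
        memLp_bdd_mul (C := 1) (mD ε) ((hΔm ε).const_mul ε).neg.aestronglyMeasurable fun z => by
          have : ε * Δ ε z = p ε z - p 0 z := by simp only [hΔ]; field_simp
          simp only [abs_neg]; rw [this]; exact hpd ε z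
      have h1 := l2norm_add_le (mΔ ε ε) m2
      have h2 : l2norm ν (fun z => -(ε * Δ ε z) * D ε z) ≤ l2norm ν (D ε) := by
        refine l2norm_mono (mD ε) fun z => ?_
        have : ε * Δ ε z = p ε z - p 0 z := by simp only [hΔ]; field_simp
        rw [this, abs_mul, abs_neg]
        exact mul_le_of_le_one_left (abs_nonneg _) (hpd ε z)
      refine le_trans (le_of_eq ?_) (h1.trans (add_le_add_right h2 _))
      congr 1; funext z; simp only [hD]; field_simp; ring
    have e1 := M.integral_quot_mul hm hA hA01 hpA hp hp01 (hΔsm ε) (hΔC ε) hε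
    have e2 := l2norm_sq (mΔ ε ε)
    have mBD : MemLp (fun z => B z * D ε z) 2 ν :=
      memLp_bdd_mul (mD ε) hBm.aestronglyMeasurable hB1
    have e3 := abs_integral_mul_le mBD ((mΔ ε ε).add (mΔ ε 0))
    have e4 : l2norm ν (fun z => B z * D ε z) ≤ l2norm ν (D ε) := by
      simpa using l2norm_bdd_mul (mD ε) zero_le_one hB1
    have e5 : l2norm ν ((fun z => Δ ε z * r ε z) + fun z => Δ ε z * r 0 z) ≤
      l2norm ν (fun z => Δ ε z * r ε z) + l2norm ν (fun z => Δ ε z * r 0 z) :=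
      l2norm_add_le (mΔ ε ε) (mΔ ε 0)
    have e6 : l2norm ν (fun z => Δ ε z * r ε z) ^ 2 ≤ l2norm ν (D ε) *
        (2 * l2norm ν (fun z => Δ ε z * r ε z) + l2norm ν (D ε)) := by
      rw [e2]
      refine (le_of_eq e1).trans ((le_abs_self _).trans (e3.trans ?_))
      exact mul_le_mul e4 (by linarith) (l2norm_nonneg _) (l2norm_nonneg _)
    have n1 := l2norm_nonneg (ν := ν) (fun z => Δ ε z * r ε z)
    have n2 := l2norm_nonneg (ν := ν) (D ε)
    have e7 : l2norm ν (fun z => Δ ε z * r ε z) ≤ 3 * l2norm ν (D ε) := by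
      by_contra hcon
      push Not at hcon
      nlinarith
    constructor <;> linarith
  -- truncated derivative
  set τ : ℝ → Z → ℝ := fun ε z => if |Δ₀ z| ≤ |ε|⁻¹ then Δ₀ z else 0 with hτ
  have hcT : Tendsto (fun ε : ℝ => |ε|⁻¹) (𝓝[≠] 0) atTop :=
    tendsto_inv_nhdsGT_zero.comp (tendsto_nhdsWithin_iff.2
      ⟨by simpa using (continuous_abs.tendsto (0 : ℝ)).mono_left nhdsWithin_le_nhds,
        hne.mono fun ε h => abs_pos.2 h⟩)
  have hτsm : ∀ ε, StronglyMeasurable[m] (τ ε) := fun ε =>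
    StronglyMeasurable.ite (measurableSet_le (measurable_norm.comp hΔ₀sm.measurable)
      measurable_const) hΔ₀sm stronglyMeasurable_const
  have hτC : ∀ ε z, |τ ε z| ≤ |ε|⁻¹ := fun ε z => by
    simp only [hτ]; split_ifs with h
    · exact h
    · simp
  have hτΔ : ∀ ε z, |τ ε z| ≤ |Δ₀ z| := fun ε z => by
    simp only [hτ]; split_ifs with h <;> simp
  have hτT : L2Tendsto ν (𝓝[≠] 0) (fun ε z => τ ε z * r 0 z) (fun z => Δ₀ z * r 0 z) := by
    refine (l2Tendsto_trunc mΔ₀ hΔ₀m hcT).congr' (Eventually.of_forall fun ε z => ?_)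
    simp only [hτ]; split_ifs <;> simp
  have mτ : ∀ ε ε', MemLp (fun z => τ ε z * r ε' z) 2 ν := fun ε ε' =>
    memLp_bdd_mul (M.memLp_root ε') ((hτsm ε).mono hm).aestronglyMeasurable (hτC ε)
  set f : ℝ → Z → ℝ := fun ε z => Δ ε z - τ ε z with hf
  have hfsm : ∀ ε, StronglyMeasurable[m] (f ε) := fun ε => (hΔsm ε).sub (hτsm ε)
  have hfm : ∀ ε, Measurable (f ε) := fun ε => ((hfsm ε).mono hm).measurable
  have hfC : ∀ ε z, |f ε z| ≤ 2 * |ε|⁻¹ := fun ε z => by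
    have := abs_sub (Δ ε z) (τ ε z)
    simp only [hf]; linarith [hΔC ε z, hτC ε z]
  have mf : ∀ ε ε', MemLp (fun z => f ε z * r ε' z) 2 ν := fun ε ε' =>
    memLp_bdd_mul (M.memLp_root ε') (hfm ε).aestronglyMeasurable (hfC ε)
  set K₂ : ℝ := 4 * K + l2norm ν (fun z => Δ₀ z * r 0 z)
  have hf0 : ∀ᶠ ε in 𝓝[≠] 0, l2norm ν (fun z => f ε z * r 0 z) ≤ K₂ := by
    filter_upwards [hbound] with ε h
    have h1 := l2norm_add_le (mΔ ε 0) (mτ ε 0).neg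
    have h2 : l2norm ν (-fun z => τ ε z * r 0 z) ≤ l2norm ν (fun z => Δ₀ z * r 0 z) :=
      l2norm_mono mΔ₀ fun z => by
        simp only [Pi.neg_apply, abs_neg, abs_mul]
        exact mul_le_mul_of_nonneg_right (hτΔ ε z) (abs_nonneg _)
    refine le_trans (le_of_eq ?_) (h1.trans (add_le_add h.2 h2))
    congr 1; funext z; simp only [hf, Pi.neg_apply]; ring
  have hεinv : ∀ (ε : ℝ) (c x : ℝ), 0 ≤ c → |x| ≤ c * |ε|⁻¹ → |ε * x| ≤ c := by
    intro ε c x hc hx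
    rcases eq_or_ne ε 0 with rfl | h
    · simpa using hc
    · rw [abs_mul]
      calc |ε| * |x| ≤ |ε| * (c * |ε|⁻¹) := mul_le_mul_of_nonneg_left hx (abs_nonneg _)
        _ = c := by field_simp [abs_ne_zero.2 h]
  have hΔdiff := M.l2Tendsto_mul_root_sub hΔm (C := 1) (C' := 4 * K) zero_le_one
    (Eventually.of_forall fun ε z => hεinv ε 1 _ zero_le_one (by simpa using hΔC ε z))
    (hbound.mono fun ε h => h.2)
  have hfdiff := M.l2Tendsto_mul_root_sub hfm (C := 2) (C' := K₂) zero_le_two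
    (Eventually.of_forall fun ε z => hεinv ε 2 _ zero_le_two (hfC ε z)) hf0
  have mrd : ∀ ε, MemLp (fun z => r ε z - r 0 z) 2 ν := fun ε =>
    (M.memLp_root ε).sub (M.memLp_root 0)
  have mfd : ∀ ε, MemLp (fun z => f ε z * (r ε z - r 0 z)) 2 ν := fun ε =>
    memLp_bdd_mul (mrd ε) (hfm ε).aestronglyMeasurable (hfC ε)
  have mΔd : ∀ ε, MemLp (fun z => Δ ε z * (r ε z - r 0 z)) 2 ν := fun ε =>
    memLp_bdd_mul (mrd ε) (hΔm ε).aestronglyMeasurable (hΔC ε)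
  have hfdiff' : Tendsto (fun ε => l2norm ν (fun z => f ε z * (r ε z - r 0 z))) (𝓝[≠] 0) (𝓝 0) :=
    by simpa [L2Tendsto] using hfdiff
  have hfsum : ∀ᶠ ε in 𝓝[≠] 0, l2norm ν (fun z => f ε z * r ε z + f ε z * r 0 z)
      ≤ 1 + 2 * K₂ := by
    filter_upwards [hf0, hfdiff'.eventually_le_const (u := 1) one_pos] with ε h1 h2
    have h3 := l2norm_add_le (mfd ε) ((mf ε 0).const_mul 2)
    rw [show l2norm ν (fun z => 2 * (f ε z * r 0 z)) = 2 * l2norm ν (fun z => f ε z * r 0 z) by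
      rw [l2norm_const_mul]; simp] at h3
    refine le_trans (le_of_eq ?_) (h3.trans (add_le_add h2 (mul_le_mul_of_nonneg_left h1
      zero_le_two)))
    congr 1; funext z; ring
  -- the limit of the scalar products
  have lim1 : Tendsto (fun ε => ∫ z, (f ε z * (r ε z - r 0 z)) *
      (Δ ε z * r ε z + Δ ε z * r 0 z) ∂ν) (𝓝[≠] 0) (𝓝 0) := by
    refine tendsto_integral_mul_zero (Eventually.of_forall mfd)
      (Eventually.of_forall fun ε => (mΔ ε ε).add (mΔ ε 0)) hfdiff' (C := 3 * K + 4 * K) ?_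
    filter_upwards [hbound] with ε h
    exact (l2norm_add_le (mΔ ε ε) (mΔ ε 0)).trans (add_le_add h.1 h.2)
  have mBs : MemLp (fun z => B z * (g z / 2 * r 0 z)) 2 ν :=
    memLp_bdd_mul M.memLp_score_mul hBm.aestronglyMeasurable hB1
  have mBe : ∀ ε, MemLp (fun z => B z * (D ε z - g z / 2 * r 0 z)) 2 ν := fun ε =>
    memLp_bdd_mul ((mD ε).sub M.memLp_score_mul) hBm.aestronglyMeasurable hB1
  have lim2 : Tendsto (fun ε => ∫ z, (B z * (D ε z - g z / 2 * r 0 z)) *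
      (f ε z * r ε z + f ε z * r 0 z) ∂ν) (𝓝[≠] 0) (𝓝 0) := by
    refine tendsto_integral_mul_zero (Eventually.of_forall mBe)
      (Eventually.of_forall fun ε => (mf ε ε).add (mf ε 0)) ?_ hfsum
    refine squeeze_zero (fun ε => l2norm_nonneg _) (fun ε => ?_) M.tendsto
    simpa using l2norm_bdd_mul (u := fun z => D ε z - g z / 2 * r 0 z)
      ((mD ε).sub M.memLp_score_mul) zero_le_one hB1
  have lim3 : Tendsto (fun ε => ∫ z, (f ε z * (r ε z - r 0 z)) * (B z * (g z / 2 * r 0 z)) ∂ν)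
      (𝓝[≠] 0) (𝓝 0) :=
    tendsto_integral_mul_zero (Eventually.of_forall mfd) (Eventually.of_forall fun ε => mBs)
      hfdiff' (Eventually.of_forall fun ε => le_rfl)
  have lim4 : Tendsto (fun ε => ∫ z, (τ ε z * r 0 z - Δ₀ z * r 0 z) * (f ε z * r 0 z) ∂ν)
      (𝓝[≠] 0) (𝓝 0) :=
    tendsto_integral_mul_zero (Eventually.of_forall fun ε => (mτ ε 0).sub mΔ₀)
      (Eventually.of_forall fun ε => mf ε 0) hτT hf0
  have hid : ∀ᶠ ε in 𝓝[≠] 0, l2norm ν (fun z => f ε z * r 0 z) ^ 2 =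
      (((∫ z, (B z * (D ε z - g z / 2 * r 0 z)) * (f ε z * r ε z + f ε z * r 0 z) ∂ν)
      + ∫ z, (f ε z * (r ε z - r 0 z)) * (B z * (g z / 2 * r 0 z)) ∂ν)
      - ∫ z, (f ε z * (r ε z - r 0 z)) * (Δ ε z * r ε z + Δ ε z * r 0 z) ∂ν)
      - ∫ z, (τ ε z * r 0 z - Δ₀ z * r 0 z) * (f ε z * r 0 z) ∂ν := by
    filter_upwards [hne] with ε hε
    have e1 := M.integral_quot_mul hm hA hA01 hpA hp hp01 (hfsm ε) (hfC ε) hε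
    have e2 : ∫ z, 2 * ((f ε z * r 0 z) * (B z * (g z / 2 * r 0 z))) ∂ν =
        ∫ z, (f ε z * r 0 z) * (Δ₀ z * r 0 z) ∂ν := by
      have hBg : Integrable (fun z => (A z - p 0 z) * g z) (Q 0 : Measure Z) :=
        (memLp_bdd_mul M.memLp_score hBm.aestronglyMeasurable hB1).integrable (by norm_num)
      have := integral_mul_condExp hm (hfsm ε) hBg (hfC ε)
      rw [M.integral_eq, M.integral_eq] at this
      calc _ = ∫ z, f ε z * ((A z - p 0 z) * g z) * (r 0 z * r 0 z) ∂ν := by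
            congr 1; funext z; simp only [hB]; ring
        _ = _ := this.symm
        _ = _ := by congr 1; funext z; simp only [hΔ₀]; ring
    have i1 := integrable_mul_of_memLp (mBe ε) ((mf ε ε).add (mf ε 0))
    have i2 := integrable_mul_of_memLp (mfd ε) mBs
    have i3 := integrable_mul_of_memLp (mfd ε) ((mΔ ε ε).add (mΔ ε 0))
    have i4 := integrable_mul_of_memLp ((mτ ε 0).sub mΔ₀) (mf ε 0)
    have i5 := integrable_mul_of_memLp (mΔ ε ε) (mf ε ε)
    have mBD : MemLp (fun z => B z * D ε z) 2 ν :=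
      memLp_bdd_mul (mD ε) hBm.aestronglyMeasurable hB1
    have i6 := integrable_mul_of_memLp mBD ((mf ε ε).add (mf ε 0))
    have i7 : Integrable (fun z => 2 * ((f ε z * r 0 z) * (B z * (g z / 2 * r 0 z)))) ν :=
      (integrable_mul_of_memLp (mf ε 0) mBs).const_mul 2
    have i8 := integrable_mul_of_memLp (mf ε 0) mΔ₀
    simp only [Pi.add_apply, Pi.sub_apply] at i1 i3 i4 i6
    have i12 := i1.add i2
    have i123 := i12.sub i3
    have i1234 := i123.sub i4
    have i56 := i5.sub i6
    have i78 := i7.sub i8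
    simp only [Pi.add_def, Pi.sub_def] at i12 i123 i1234 i56 i78
    rw [← sub_eq_zero] at e1 e2
    rw [← integral_sub i5 i6] at e1
    rw [← integral_sub i7 i8] at e2
    have e3 := congrArg₂ (· + ·) e1 e2
    simp only [add_zero] at e3
    rw [← integral_add i56 i78] at e3
    rw [l2norm_sq (mf ε 0), ← integral_add i1 i2, ← integral_sub i12 i3, ← integral_sub i123 i4,
      ← sub_eq_zero, ← integral_sub (integrable_mul_of_memLp (mf ε 0) (mf ε 0)) i1234]
    refine Eq.trans ?_ e3
    congr 1; funext z
    simp only [hf, hD]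
    ring
  have hlim : Tendsto (fun ε => l2norm ν (fun z => f ε z * r 0 z)) (𝓝[≠] 0) (𝓝 0) := by
    have h1 := ((lim2.add lim3).sub lim1).sub lim4
    simp only [add_zero, sub_zero] at h1
    have h2 := (h1.congr' (hid.mono fun ε h => h.symm)).sqrt
    simp only [Real.sqrt_zero] at h2
    exact h2.congr fun ε => Real.sqrt_sq (l2norm_nonneg _)
  have hlim' : L2Tendsto ν (𝓝[≠] 0) (fun ε z => f ε z * r 0 z) 0 := by
    simpa [L2Tendsto] using hlim
  have s1 := hlim'.add hτT (Eventually.of_forall fun ε => mf ε 0)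
    (Eventually.of_forall fun ε => mτ ε 0) MemLp.zero mΔ₀
  have s2 := s1.add hΔdiff (Eventually.of_forall fun ε => (mf ε 0).add (mτ ε 0))
    (Eventually.of_forall mΔd) (MemLp.zero.add mΔ₀) MemLp.zero
  refine s2.congr' (Eventually.of_forall fun ε z => ?_)
  simp only [hf, Pi.zero_apply]
  ring

end CondExpDerivative

end RootModel

end Efficiency

namespace Efficiency

namespace RootModel

section Derivative

variable {Z : Type*} [MeasurableSpace Z] {ν : Measure Z} {r : ℝ → Z → ℝ}
  {Q : ℝ → ProbabilityMeasure Z} {g : Z → ℝ}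

/-- A uniformly bounded family of functions which is differentiable at `0` in `L²`, along a model
with root densities `r`, with derivative `k'`. -/
structure HasL2Deriv (ν : Measure Z) (r : ℝ → Z → ℝ) (k : ℝ → Z → ℝ) (k' : Z → ℝ) : Prop where
  measurable : ∀ ε, Measurable (k ε)
  bounded : ∃ C, 0 ≤ C ∧ ∀ ε z, |k ε z| ≤ C
  measurable_deriv : Measurable k'
  memLp_deriv : MemLp (fun z => k' z * r 0 z) 2 ν
  tendsto : L2Tendsto ν (𝓝[≠] 0) (fun ε z => (k ε z - k 0 z) / ε * r ε z)
    (fun z => k' z * r 0 z)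

lemma HasL2Deriv.const {k : Z → ℝ} (hk : Measurable k) {C : ℝ} (hC : ∀ z, |k z| ≤ C) :
    HasL2Deriv ν r (fun _ => k) 0 where
  measurable _ := hk
  bounded := ⟨|C|, abs_nonneg _, fun _ z => (hC z).trans (le_abs_self C)⟩
  measurable_deriv := measurable_const
  memLp_deriv := by simp
  tendsto := by
    have : l2norm ν (fun _ => 0) = 0 := by simp [l2norm]
    simp [L2Tendsto, this]

lemma HasL2Deriv.memLp_quot (M : RootModel ν r Q g) {k : ℝ → Z → ℝ} {k' : Z → ℝ}
    (h : HasL2Deriv ν r k k') (ε : ℝ) : MemLp (fun z => (k ε z - k 0 z) / ε * r ε z) 2 ν := by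
  obtain ⟨C, hC, hb⟩ := h.bounded
  refine memLp_bdd_mul (C := 2 * C / |ε|) (M.memLp_root ε)
    (((h.measurable ε).sub (h.measurable 0)).div_const ε).aestronglyMeasurable fun z => ?_
  rw [abs_div]
  have := abs_sub (k ε z) (k 0 z)
  exact div_le_div_of_nonneg_right (by linarith [hb ε z, hb 0 z]) (abs_nonneg _)

lemma HasL2Deriv.l2Tendsto_sub_mul (M : RootModel ν r Q g) {k : ℝ → Z → ℝ} {k' : Z → ℝ}
    (h : HasL2Deriv ν r k k') :
    L2Tendsto ν (𝓝[≠] 0) (fun ε z => (k ε z - k 0 z) * r ε z) 0 := by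
  have hb := h.tendsto.eventually_le (Eventually.of_forall (h.memLp_quot M)) h.memLp_deriv
  set K := 1 + l2norm ν (fun z => k' z * r 0 z)
  have hid : Tendsto (fun ε : ℝ => |ε| * K) (𝓝[≠] 0) (𝓝 0) := by
    have : Tendsto (fun ε : ℝ => |ε| * K) (𝓝 0) (𝓝 (|0| * K)) :=
      (continuous_abs.tendsto 0).mul_const _
    simp only [abs_zero, zero_mul] at this
    exact this.mono_left nhdsWithin_le_nhds
  refine squeeze_zero' (Eventually.of_forall fun i => l2norm_nonneg _) ?_ hid
  filter_upwards [hb, self_mem_nhdsWithin] with ε h1 h2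
  refine le_trans (le_of_eq ?_) (mul_le_mul_of_nonneg_left h1 (abs_nonneg ε))
  rw [← l2norm_const_mul]
  congr 1; funext z; simp only [Pi.zero_apply]; field_simp [show ε ≠ 0 from h2]; ring

lemma HasL2Deriv.congr_deriv {k : ℝ → Z → ℝ} {k' k'' : Z → ℝ} (h : HasL2Deriv ν r k k')
    (he : ∀ z, k' z = k'' z) : HasL2Deriv ν r k k'' := by
  rwa [show k'' = k' from funext fun z => (he z).symm]

lemma HasL2Deriv.mul (M : RootModel ν r Q g) {k l : ℝ → Z → ℝ} {k' l' : Z → ℝ}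
    (hk : HasL2Deriv ν r k k') (hl : HasL2Deriv ν r l l') :
    HasL2Deriv ν r (fun ε z => k ε z * l ε z) (fun z => k' z * l 0 z + k 0 z * l' z) := by
  obtain ⟨C, hC, hkC⟩ := hk.bounded
  obtain ⟨C', hC', hlC⟩ := hl.bounded
  have m1 : MemLp (fun z => l 0 z * (k' z * r 0 z)) 2 ν :=
    memLp_bdd_mul hk.memLp_deriv (hl.measurable 0).aestronglyMeasurable (hlC 0)
  have m2 : MemLp (fun z => k 0 z * (l' z * r 0 z)) 2 ν :=
    memLp_bdd_mul hl.memLp_deriv (hk.measurable 0).aestronglyMeasurable (hkC 0)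
  refine ⟨fun ε => (hk.measurable ε).mul (hl.measurable ε),
    ⟨C * C', by positivity, fun ε z => ?_⟩,
    (hk.measurable_deriv.mul (hl.measurable 0)).add ((hk.measurable 0).mul hl.measurable_deriv),
    (m1.add m2).ae_eq (Eventually.of_forall fun z => ?_), ?_⟩
  · rw [abs_mul]; exact mul_le_mul (hkC ε z) (hlC ε z) (abs_nonneg _) hC
  · simp only [Pi.add_apply]; ring
  · have t1 : L2Tendsto ν (𝓝[≠] 0) (fun ε z => l 0 z * ((k ε z - k 0 z) / ε * r ε z))
        (fun z => l 0 z * (k' z * r 0 z)) := by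
      refine hk.tendsto.bdd_mul (k := fun _ => l 0) (Eventually.of_forall (hk.memLp_quot M))
        hk.memLp_deriv (fun _ => (hl.measurable 0).aestronglyMeasurable)
        (hl.measurable 0).aestronglyMeasurable hC' (Eventually.of_forall fun _ => hlC 0) (hlC 0) ?_
      have : l2norm ν (fun _ => 0) = 0 := by simp [l2norm]
      simp [L2Tendsto, this]
    have t2 : L2Tendsto ν (𝓝[≠] 0) (fun ε z => k ε z * ((l ε z - l 0 z) / ε * r ε z))
        (fun z => k 0 z * (l' z * r 0 z)) :=
      hl.tendsto.bdd_mul (k := k) (Eventually.of_forall (hl.memLp_quot M))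
        hl.memLp_deriv (fun ε => (hk.measurable ε).aestronglyMeasurable)
        (hk.measurable 0).aestronglyMeasurable hC (Eventually.of_forall hkC) (hkC 0)
        (M.l2Tendsto_mul_of_bdd hk.measurable (hk.measurable 0) hC hkC (hkC 0)
          (hk.l2Tendsto_sub_mul M) hl.measurable_deriv hl.memLp_deriv)
    refine (t1.add t2 (Eventually.of_forall fun ε => memLp_bdd_mul (hk.memLp_quot M ε)
        (hl.measurable 0).aestronglyMeasurable (hlC 0))
      (Eventually.of_forall fun ε => memLp_bdd_mul (hl.memLp_quot M ε)
        (hk.measurable ε).aestronglyMeasurable (hkC ε)) m1 m2).congr'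
      (Eventually.of_forall fun ε z => ?_)
    ring

/-- Differentiability of the reciprocal of a family bounded away from `0`. -/
lemma HasL2Deriv.inv (M : RootModel ν r Q g) {k : ℝ → Z → ℝ} {k' : Z → ℝ}
    (hk : HasL2Deriv ν r k k') {c : ℝ} (hc : 0 < c) (hkc : ∀ ε z, c ≤ k ε z) :
    HasL2Deriv ν r (fun ε z => (k ε z)⁻¹) (fun z => -k' z / k 0 z ^ 2) := by
  have hpos : ∀ ε z, 0 < k ε z := fun ε z => hc.trans_le (hkc ε z)
  have hi : ∀ ε z, |(k ε z)⁻¹| ≤ c⁻¹ := fun ε z => by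
    rw [abs_of_pos (inv_pos.2 (hpos ε z))]
    exact inv_anti₀ hc (hkc ε z)
  have hq : ∀ ε z, |-((k ε z)⁻¹ * (k 0 z)⁻¹)| ≤ c⁻¹ * c⁻¹ := fun ε z => by
    rw [abs_neg, abs_mul]
    exact mul_le_mul (hi ε z) (hi 0 z) (abs_nonneg _) (inv_pos.2 hc).le
  have hqm : ∀ ε, Measurable (fun z => -((k ε z)⁻¹ * (k 0 z)⁻¹)) := fun ε =>
    ((hk.measurable ε).inv.mul (hk.measurable 0).inv).neg
  have hcc : 0 ≤ c⁻¹ * c⁻¹ := by positivity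
  obtain ⟨C, hC, hkC⟩ := hk.bounded
  refine ⟨fun ε => (hk.measurable ε).inv, ⟨c⁻¹, (inv_pos.2 hc).le, hi⟩,
    hk.measurable_deriv.neg.div ((hk.measurable 0).pow_const 2), ?_, ?_⟩
  · refine (memLp_bdd_mul hk.memLp_deriv (hqm 0).aestronglyMeasurable (hq 0)).ae_eq
      (Eventually.of_forall fun z => ?_)
    have := (hpos 0 z).ne'
    simp only []
    field_simp
  · have hconv : L2Tendsto ν (𝓝[≠] 0) (fun ε z => (-((k ε z)⁻¹ * (k 0 z)⁻¹) -
        -((k 0 z)⁻¹ * (k 0 z)⁻¹)) * r ε z) 0 := by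
      have h0 := hk.l2Tendsto_sub_mul M
      have hT := Tendsto.const_mul (c⁻¹ * c⁻¹ * c⁻¹) h0
      rw [mul_zero] at hT
      refine squeeze_zero (fun ε => l2norm_nonneg _) (fun ε => ?_) hT
      refine l2norm_le_mul ?_ (by positivity) fun z => ?_
      · have m1 : MemLp (fun z => (k ε z - k 0 z) * r ε z) 2 ν :=
          memLp_bdd_mul (C := 2 * C) (M.memLp_root ε)
            ((hk.measurable ε).sub (hk.measurable 0)).aestronglyMeasurable fun z => by
              have := abs_sub (k ε z) (k 0 z)
              linarith [hkC ε z, hkC 0 z]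
        simpa using m1
      · have e : (-((k ε z)⁻¹ * (k 0 z)⁻¹) - -((k 0 z)⁻¹ * (k 0 z)⁻¹)) * r ε z - (0 : Z → ℝ) z =
            (k ε z)⁻¹ * (k 0 z)⁻¹ * (k 0 z)⁻¹ * ((k ε z - k 0 z) * r ε z - (0 : Z → ℝ) z) := by
          have h1 := (hpos 0 z).ne'
          have h2 := (hpos ε z).ne'
          simp only [Pi.zero_apply]
          field_simp
          ring
        rw [e, abs_mul]
        refine mul_le_mul_of_nonneg_right ?_ (abs_nonneg _)
        rw [abs_mul, abs_mul]
        exact mul_le_mul (mul_le_mul (hi ε z) (hi 0 z) (abs_nonneg _) (inv_pos.2 hc).le) (hi 0 z)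
          (abs_nonneg _) hcc
    have t2 := hk.tendsto.bdd_mul (k := fun ε z => -((k ε z)⁻¹ * (k 0 z)⁻¹))
      (Eventually.of_forall (hk.memLp_quot M))
      hk.memLp_deriv (fun ε => (hqm ε).aestronglyMeasurable)
      (hqm 0).aestronglyMeasurable hcc (Eventually.of_forall hq) (hq 0)
      (M.l2Tendsto_mul_of_bdd hqm (hqm 0) hcc hq (hq 0) hconv hk.measurable_deriv hk.memLp_deriv)
    refine t2.congr' (Eventually.of_forall fun ε z => ?_)
    have h1 := (hpos 0 z).ne'
    have h2 := (hpos ε z).ne'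
    rcases eq_or_ne ε 0 with rfl | hε
    · simp only [div_zero, zero_mul, mul_zero]; field_simp
    · field_simp
      ring

/-- The logarithmic derivative of a finite product is the sum of the logarithmic derivatives. -/
lemma HasL2Deriv.prod (M : RootModel ν r Q g) {ι : Type*} (s : Finset ι) {k : ι → ℝ → Z → ℝ}
    {k' : ι → Z → ℝ} (h : ∀ i ∈ s, HasL2Deriv ν r (k i) (fun z => k i 0 z * k' i z)) :
    HasL2Deriv ν r (fun ε z => ∏ i ∈ s, k i ε z)
      (fun z => (∏ i ∈ s, k i 0 z) * ∑ i ∈ s, k' i z) := by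
  classical
  induction s using Finset.induction_on with
  | empty =>
    simp only [Finset.prod_empty, Finset.sum_empty, mul_zero]
    exact HasL2Deriv.const (C := 1) measurable_const (by simp)
  | insert i s hi ih =>
    have h1 := (h i (Finset.mem_insert_self i s)).mul M
      (ih fun j hj => h j (Finset.mem_insert_of_mem hj))
    simp only [Finset.prod_insert hi, Finset.sum_insert hi]
    exact h1.congr_deriv fun z => by ring

/-- Weak convergence of `Y * r ε`. -/
lemma tendsto_integral_mul_root (M : RootModel ν r Q g) {Y f : Z → ℝ} (hY : Measurable Y) {C : ℝ}
    (hYm : ∀ᶠ ε in 𝓝[≠] 0, MemLp (fun z => Y z * r ε z) 2 ν)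
    (hYC : ∀ᶠ ε in 𝓝[≠] 0, l2norm ν (fun z => Y z * r ε z) ≤ C)
    (hY0 : MemLp (fun z => Y z * r 0 z) 2 ν)
    (hfm : MemLp (fun z => f z * r 0 z) 2 ν) :
    Tendsto (fun ε => ∫ z, (f z * r 0 z) * (Y z * r ε z) ∂ν) (𝓝[≠] 0)
      (𝓝 (∫ z, (f z * r 0 z) * (Y z * r 0 z) ∂ν)) := by
  have hCnn : 0 ≤ C := by
    obtain ⟨ε, h⟩ := hYC.exists
    exact (l2norm_nonneg _).trans h
  set K := C + l2norm ν (fun z => Y z * r 0 z) + 1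
  have hK : 0 < K := by have := l2norm_nonneg (ν := ν) (fun z => Y z * r 0 z); positivity
  have ht := l2Tendsto_trunc hfm hY (tendsto_natCast_atTop_atTop (R := ℝ))
  rw [Metric.tendsto_nhds]
  intro η hη
  obtain ⟨n, hn⟩ := (ht.eventually_lt_const (u := η / (2 * K)) (by positivity)).exists
  have hset : MeasurableSet {z | |Y z| ≤ (n : ℝ)} := measurableSet_le hY.abs measurable_const
  have mt : MemLp (fun z => if |Y z| ≤ (n : ℝ) then f z * r 0 z else 0) 2 ν := hfm.indicator hset
  have mb : MemLp (fun z => (if |Y z| ≤ (n : ℝ) then Y z else 0) * (f z * r 0 z)) 2 ν :=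
    memLp_bdd_mul (C := n) hfm (Measurable.ite hset hY measurable_const).aestronglyMeasurable
      fun z => by split_ifs with h <;> simp [h]
  have lim := tendsto_integral_mul_zero (u := fun ε z => r ε z - r 0 z)
    (v := fun _ z => (if |Y z| ≤ (n : ℝ) then Y z else 0) * (f z * r 0 z))
    (Eventually.of_forall fun ε => (M.memLp_root ε).sub (M.memLp_root 0))
    (Eventually.of_forall fun _ => mb) M.l2Tendsto_root (Eventually.of_forall fun _ => le_rfl)
  have lim' := (Metric.tendsto_nhds.1 lim) (η / 2) (by positivity)
  filter_upwards [lim', hYm, hYC] with ε h1 h2 h3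
  rw [dist_zero_right, Real.norm_eq_abs] at h1
  rw [Real.dist_eq]
  have md : MemLp (fun z => (if |Y z| ≤ (n : ℝ) then f z * r 0 z else 0) - f z * r 0 z) 2 ν :=
    mt.sub hfm
  have mY : MemLp (fun z => Y z * r 0 z - Y z * r ε z) 2 ν := hY0.sub h2
  have e1 := abs_integral_mul_le md mY
  have e2 : l2norm ν (fun z => Y z * r 0 z - Y z * r ε z) ≤ K := by
    have := l2norm_add_le hY0 h2.neg
    have h4 : l2norm ν (-fun z => Y z * r ε z) = l2norm ν (fun z => Y z * r ε z) := by
      simp [l2norm, eLpNorm_neg]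
    rw [h4] at this
    refine le_trans (le_of_eq ?_) (this.trans ?_)
    · congr 1
    · simp only [K]; linarith
  have e3 : ∫ z, (f z * r 0 z) * (Y z * r ε z) ∂ν - ∫ z, (f z * r 0 z) * (Y z * r 0 z) ∂ν =
      ∫ z, (r ε z - r 0 z) * ((if |Y z| ≤ (n : ℝ) then Y z else 0) * (f z * r 0 z)) ∂ν +
      ∫ z, ((if |Y z| ≤ (n : ℝ) then f z * r 0 z else 0) - f z * r 0 z) *
        (Y z * r 0 z - Y z * r ε z) ∂ν := by
    rw [← integral_sub (integrable_mul_of_memLp hfm h2) (integrable_mul_of_memLp hfm hY0),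
      ← integral_add (integrable_mul_of_memLp (u := fun z => r ε z - r 0 z)
        ((M.memLp_root ε).sub (M.memLp_root 0)) mb) (integrable_mul_of_memLp md mY)]
    congr 1; funext z
    split_ifs <;> ring
  rw [e3]
  have e4 : l2norm ν (fun z => (if |Y z| ≤ (n : ℝ) then f z * r 0 z else 0) - f z * r 0 z) *
      l2norm ν (fun z => Y z * r 0 z - Y z * r ε z) ≤ η / (2 * K) * K :=
    mul_le_mul hn.le e2 (l2norm_nonneg _) (by positivity)
  have e5 : η / (2 * K) * K = η / 2 := by field_simp
  calc _ ≤ _ := abs_add_le _ _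
    _ < η / 2 + η / 2 := add_lt_add_of_lt_of_le h1 (e1.trans (e4.trans e5.le))
    _ = η := by ring

/-- Differentiability of `ε ↦ E_ε (k_ε Y)` for a differentiable bounded family `k`, when `Y` has
bounded second moments along the model. -/
theorem hasDerivAt_integral_mul (M : RootModel ν r Q g) {k : ℝ → Z → ℝ} {k' : Z → ℝ}
    (hk : HasL2Deriv ν r k k') {Y : Z → ℝ} (hY : Measurable Y) {C : ℝ}
    (hYm : ∀ᶠ ε in 𝓝 0, MemLp (fun z => Y z * r ε z) 2 ν)
    (hYC : ∀ᶠ ε in 𝓝 0, l2norm ν (fun z => Y z * r ε z) ≤ C) :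
    HasDerivAt (fun ε => ∫ z, k ε z * Y z ∂(Q ε : Measure Z))
      (∫ z, k' z * Y z ∂(Q 0 : Measure Z) + ∫ z, k 0 z * Y z * g z ∂(Q 0 : Measure Z)) 0 := by
  obtain ⟨B, hB, hkB⟩ := hk.bounded
  have hY0 := hYm.self_of_nhds
  have hYm' := hYm.filter_mono (nhdsWithin_le_nhds (s := {0}ᶜ))
  have hYC' := hYC.filter_mono (nhdsWithin_le_nhds (s := {0}ᶜ))
  rw [hasDerivAt_iff_tendsto_slope]
  have t1 := tendsto_integral_mul hk.tendsto (Eventually.of_forall (hk.memLp_quot M))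
    hk.memLp_deriv hYm' hYC'
    (M.tendsto_integral_mul_root hY hYm' hYC' hY0 hk.memLp_deriv)
  have mks : ∀ ε, MemLp (fun z => Y z * r ε z) 2 ν → MemLp (fun z => k 0 z * (Y z * r ε z)) 2 ν :=
    fun ε h => memLp_bdd_mul h (hk.measurable 0).aestronglyMeasurable (hkB 0)
  have lks : ∀ ε, MemLp (fun z => Y z * r ε z) 2 ν →
      l2norm ν (fun z => k 0 z * (Y z * r ε z)) ≤ B * l2norm ν (fun z => Y z * r ε z) :=
    fun ε h => l2norm_bdd_mul h hB (hkB 0)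
  have t2 : Tendsto (fun ε => ∫ z, ((r ε z - r 0 z) / ε) *
      (k 0 z * Y z * r ε z + k 0 z * Y z * r 0 z) ∂ν) (𝓝[≠] 0)
      (𝓝 (∫ z, k 0 z * Y z * g z * (r 0 z * r 0 z) ∂ν)) := by
    refine tendsto_integral_mul M.tendsto (Eventually.of_forall M.memLp_quot) M.memLp_score_mul
      (C := B * C + B * C) ?_ ?_ ?_
    · filter_upwards [hYm'] with ε h
      refine ((mks ε h).add (mks 0 hY0)).ae_eq (Eventually.of_forall fun z => ?_)
      simp only [Pi.add_apply]; ring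
    · filter_upwards [hYm', hYC'] with ε h1 h2
      have h3 := l2norm_add_le (mks ε h1) (mks 0 hY0)
      have h4 := lks ε h1
      have h5 := lks 0 hY0
      have h6 := hYC.self_of_nhds
      have h7 : l2norm ν (fun z => k 0 z * Y z * r ε z + k 0 z * Y z * r 0 z) =
        l2norm ν (fun z => k 0 z * (Y z * r ε z) + k 0 z * (Y z * r 0 z)) := by
          congr 1; funext z; ring
      rw [h7]
      nlinarith
    · have mf : MemLp (fun z => (k 0 z * (g z / 2)) * r 0 z) 2 ν :=
        (memLp_bdd_mul M.memLp_score_mul (hk.measurable 0).aestronglyMeasurable (hkB 0)).ae_eq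
          (Eventually.of_forall fun z => by ring)
      have h1 := M.tendsto_integral_mul_root (f := fun z => k 0 z * (g z / 2)) hY hYm' hYC'
        hY0 mf
      have h2 := h1.add_const (∫ z, (k 0 z * (g z / 2) * r 0 z) * (Y z * r 0 z) ∂ν)
      have e : ∫ z, k 0 z * Y z * g z * (r 0 z * r 0 z) ∂ν =
          ∫ z, (k 0 z * (g z / 2) * r 0 z) * (Y z * r 0 z) ∂ν +
          ∫ z, (k 0 z * (g z / 2) * r 0 z) * (Y z * r 0 z) ∂ν := by
        rw [← integral_add (integrable_mul_of_memLp mf hY0) (integrable_mul_of_memLp mf hY0)]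
        congr 1; funext z; ring
      rw [e]
      refine h2.congr' ?_
      filter_upwards [hYm'] with ε h
      rw [← integral_add (integrable_mul_of_memLp mf h) (integrable_mul_of_memLp mf hY0)]
      congr 1; funext z; ring
  have t3 := t1.add t2
  rw [M.integral_eq, M.integral_eq]
  have e : ∫ z, k' z * Y z * (r 0 z * r 0 z) ∂ν = ∫ z, (k' z * r 0 z) * (Y z * r 0 z) ∂ν := by
    congr 1; funext z; ring
  rw [e]
  refine t3.congr' ?_
  filter_upwards [hYm', self_mem_nhdsWithin] with ε h hε
  have hε' : ε ≠ 0 := hε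
  have msum : MemLp (fun z => k 0 z * Y z * r ε z + k 0 z * Y z * r 0 z) 2 ν :=
    ((mks ε h).add (mks 0 hY0)).ae_eq (Eventually.of_forall fun z => by
      simp only [Pi.add_apply]; ring)
  have mk : ∀ ε, MemLp (fun z => k ε z * r ε z) 2 ν := fun ε =>
    memLp_bdd_mul (M.memLp_root ε) (hk.measurable ε).aestronglyMeasurable (hkB ε)
  have e1 : ∀ ε, ∫ z, k ε z * Y z ∂(Q ε : Measure Z) = ∫ z, (k ε z * r ε z) * (Y z * r ε z) ∂ν := by
    intro ε; rw [M.integral_eq]; congr 1; funext z; ring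
  rw [slope_def_field, e1, e1, ← integral_sub (integrable_mul_of_memLp (mk ε) h)
    (integrable_mul_of_memLp (mk 0) hY0), ← integral_add (integrable_mul_of_memLp
    (hk.memLp_quot M ε) h) (integrable_mul_of_memLp (M.memLp_quot ε) msum), sub_zero,
    ← integral_div]
  congr 1; funext z
  field_simp
  ring

end Derivative

end RootModel

end Efficiency

namespace Incremental

section Restriction

variable {T : ℕ} {X : Fin T → Type*}

/-- The treatments with index in `S'` and the covariates with index in `S`. -/
def restr (S S' : Set (Fin T)) (w : Traj X) : ((s : S) → X s) × (S' → Bool) :=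
  (fun s => w.1 s, fun s => w.2 s)

/-- `F` depends only on the treatments with index in `S'` and the covariates with index in `S`. -/
def DependsOnly (S S' : Set (Fin T)) (F : Traj X → ℝ) : Prop :=
  ∀ w w' : Traj X, (∀ s ∈ S, w.1 s = w'.1 s) → (∀ s ∈ S', w.2 s = w'.2 s) → F w = F w'

open Classical in
/-- Extension of partial trajectories by arbitrary values. -/
noncomputable def extend [∀ t, Nonempty (X t)] (S S' : Set (Fin T))
    (p : ((s : S) → X s) × (S' → Bool)) : Traj X :=
  (fun s => if h : s ∈ S then p.1 ⟨s, h⟩ else Classical.arbitrary _,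
    fun s => if h : s ∈ S' then p.2 ⟨s, h⟩ else false)

lemma extend_restr_fst [∀ t, Nonempty (X t)] {S S' : Set (Fin T)} (w : Traj X) {s : Fin T}
    (hs : s ∈ S) : (extend S S' (restr S S' w)).1 s = w.1 s := by
  simp [extend, restr, hs]

lemma extend_restr_snd [∀ t, Nonempty (X t)] {S S' : Set (Fin T)} (w : Traj X) {s : Fin T}
    (hs : s ∈ S') : (extend S S' (restr S S' w)).2 s = w.2 s := by
  simp [extend, restr, hs]

lemma DependsOnly.mono {S S' U U' : Set (Fin T)} {F : Traj X → ℝ} (h : DependsOnly S S' F)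
    (hS : S ⊆ U) (hS' : S' ⊆ U') : DependsOnly U U' F :=
  fun w w' h1 h2 => h w w' (fun s hs => h1 s (hS hs)) fun s hs => h2 s (hS' hs)

variable [∀ t, MeasurableSpace (X t)]

/-- The σ-algebra on observations generated by the treatments in `S'` and the covariates in
`S`. -/
abbrev restrAlg (X : Fin T → Type*) [∀ t, MeasurableSpace (X t)] (S S' : Set (Fin T)) :
    MeasurableSpace (Obs X) :=
  MeasurableSpace.comap (fun z : Obs X => restr S S' z.1) inferInstance

lemma measurable_restr (S S' : Set (Fin T)) : Measurable (restr S S' : Traj X → _) := by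
  unfold restr; fun_prop

lemma restrAlg_le (S S' : Set (Fin T)) :
    restrAlg X S S' ≤ (inferInstance : MeasurableSpace (Obs X)) :=
  ((measurable_restr S S').comp measurable_fst).comap_le

lemma measurable_extend [∀ t, Nonempty (X t)] (S S' : Set (Fin T)) :
    Measurable (extend S S' : _ → Traj X) := by
  unfold extend
  refine Measurable.prodMk (measurable_pi_lambda _ fun s => ?_) (measurable_pi_lambda _ fun s => ?_)
  · by_cases h : s ∈ S
    · simp only [h, dite_true]; fun_prop
    · simp only [h, dite_false]; fun_prop
  · by_cases h : s ∈ S'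
    · simp only [h, dite_true]; fun_prop
    · simp only [h, dite_false]; fun_prop

lemma DependsOnly.stronglyMeasurable [∀ t, Nonempty (X t)] {S S' : Set (Fin T)} {F : Traj X → ℝ}
    (h : DependsOnly S S' F) (hF : Measurable F) :
    StronglyMeasurable[restrAlg X S S'] (fun z : Obs X => F z.1) := by
  have : (fun z : Obs X => F z.1) =
      (fun p => F (extend S S' p)) ∘ (fun z : Obs X => restr S S' z.1) := by
    funext z
    exact h _ _ (fun s hs => (extend_restr_fst z.1 hs).symm)
      fun s hs => (extend_restr_snd z.1 hs).symm
  rw [this]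
  exact ((hF.comp (measurable_extend S S')).comp (comap_measurable _)).stronglyMeasurable

lemma restrAlg_mono [∀ t, Nonempty (X t)] {S S' U U' : Set (Fin T)} (hS : S ⊆ U) (hS' : S' ⊆ U') :
    restrAlg X S S' ≤ restrAlg X U U' := by
  have : (fun z : Obs X => restr S S' z.1) =
      (fun p => restr S S' (extend U U' p)) ∘ (fun z : Obs X => restr U U' z.1) := by
    funext z
    refine Prod.ext (funext fun s => ?_) (funext fun s => ?_)
    · exact (extend_restr_fst z.1 (hS s.2)).symm
    · exact (extend_restr_snd z.1 (hS' s.2)).symm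
  unfold restrAlg
  rw [this, ← MeasurableSpace.comap_comp]
  exact MeasurableSpace.comap_mono
    ((measurable_restr S S').comp (measurable_extend U U')).comap_le

lemma restrAlg_univ [∀ t, Nonempty (X t)] {S S' : Set (Fin T)} (hS : ∀ s, s ∈ S)
    (hS' : ∀ s, s ∈ S') :
    restrAlg X S S' = MeasurableSpace.comap (fun z : Obs X => z.1) inferInstance := by
  refine le_antisymm ?_ ?_
  · have : (fun z : Obs X => restr S S' z.1) = restr S S' ∘ fun z => z.1 := rfl
    unfold restrAlg
    rw [this, ← MeasurableSpace.comap_comp]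
    exact MeasurableSpace.comap_mono (measurable_restr S S').comap_le
  · have : (fun z : Obs X => z.1) = extend S S' ∘ fun z => restr S S' z.1 := by
      funext z
      exact Prod.ext (funext fun s => (extend_restr_fst z.1 (hS s)).symm)
        (funext fun s => (extend_restr_snd z.1 (hS' s)).symm)
    unfold restrAlg
    rw [this, ← MeasurableSpace.comap_comp]
    exact MeasurableSpace.comap_mono (measurable_extend S S').comap_le

end Restriction

section CondExp

variable {T : ℕ} {X : Fin T → Type*} [∀ t, MeasurableSpace (X t)]
  {P : ProbabilityMeasure (Obs X)}

lemma dependsOnly_propensity (P : ProbabilityMeasure (Obs X)) (t : Fin T) :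
    DependsOnly (Set.Iic t) (Set.Iio t) (propensity P t) := by
  intro w w' h1 h2
  have : hist t w = hist t w' :=
    Prod.ext (funext fun s => h1 s s.2) (funext fun s => h2 s s.2)
  simp only [propensity, this]

lemma measurable_propensity (P : ProbabilityMeasure (Obs X)) (t : Fin T) :
    Measurable (propensity P t) := by
  have h : Measurable (hist t : Traj X → _) := measurable_restr (Set.Iic t) (Set.Iio t)
  exact ((Kernel.measurable_coe _ (measurableSet_singleton _)).ennreal_toReal).comp h

lemma propensity_mem_Icc (P : ProbabilityMeasure (Obs X)) (t : Fin T) (w : Traj X) :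
    propensity P t w ∈ Set.Icc (0 : ℝ) 1 :=
  ⟨measureReal_nonneg, measureReal_le_one⟩

lemma ind_eq_zero_or_one (b : Bool) : ind b = 0 ∨ ind b = 1 := by
  cases b <;> simp [ind]

lemma measurable_ind : Measurable ind := measurable_of_countable _

/-- Conditional expectation given the history `H_t` of a function of `(H_t, A_t)`. -/
lemma condExp_hist [∀ t, Nonempty (X t)] {t : Fin T} {F : Traj X → ℝ}
    (hF : Measurable F) (hd : DependsOnly (Set.Iic t) (Set.Iic t) F)
    (hi : Integrable (fun z : Obs X => F z.1) (P : Measure (Obs X))) :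
    (P : Measure (Obs X))[fun z => F z.1 | restrAlg X (Set.Iic t) (Set.Iio t)]
      =ᵐ[(P : Measure (Obs X))] fun z =>
        propensity P t z.1 * F (z.1.1, Function.update z.1.2 t true) +
          (1 - propensity P t z.1) * F (z.1.1, Function.update z.1.2 t false) := by
  set f : (((s : Set.Iic t) → X s) × (Set.Iio t → Bool)) × Bool → ℝ := fun q =>
    F ((extend (Set.Iic t) (Set.Iio t) q.1).1,
      Function.update (extend (Set.Iic t) (Set.Iio t) q.1).2 t q.2) with hf
  have hfm : Measurable f := by
    have h1 : Measurable fun q : (((s : Set.Iic t) → X s) × (Set.Iio t → Bool)) × Bool =>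
        extend (X := X) (Set.Iic t) (Set.Iio t) q.1 := (measurable_extend _ _).comp measurable_fst
    refine hF.comp (h1.fst.prodMk (measurable_pi_lambda _ fun s => ?_))
    by_cases h : s = t
    · subst h; simpa using measurable_snd
    · simp only [Function.update_of_ne h]
      exact (measurable_pi_apply s).comp h1.snd
  have hfe : ∀ (z : Obs X) (b : Bool), f (hist t z.1, b) =
      F (z.1.1, Function.update z.1.2 t b) := by
    intro z b
    refine hd _ _ (fun s hs => extend_restr_fst z.1 hs) fun s hs => ?_
    by_cases h : s = t
    · subst h; simp
    · simp only [Function.update_of_ne h]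
      exact extend_restr_snd (S := Set.Iic t) z.1 (lt_of_le_of_ne hs h)
  have hfe' : (fun z : Obs X => f (hist t z.1, z.1.2 t)) = fun z => F z.1 := by
    funext z; rw [hfe]; simp
  have hX : Measurable (fun z : Obs X => hist t z.1) :=
    (measurable_restr (Set.Iic t) (Set.Iio t)).comp measurable_fst
  have hY : Measurable (fun z : Obs X => z.1.2 t) := by fun_prop
  have key := condExp_prod_ae_eq_integral_condDistrib (μ := (P : Measure (Obs X))) hX
    hY.aemeasurable hfm.stronglyMeasurable (by rw [hfe']; exact hi)
  rw [hfe'] at key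
  refine key.trans (Eventually.of_forall fun z => ?_)
  simp only [hfe]
  rw [integral_fintype (by exact Integrable.of_finite)]
  simp only [Fintype.sum_bool, smul_eq_mul]
  have h1 : ((condDistrib (fun z : Obs X => z.1.2 t) (fun z : Obs X => hist t z.1)
      (P : Measure (Obs X))) (hist t z.1)).real {false} = 1 - propensity P t z.1 := by
    have := measureReal_compl (μ := (condDistrib (fun z : Obs X => z.1.2 t)
      (fun z : Obs X => hist t z.1) (P : Measure (Obs X))) (hist t z.1))
      (measurableSet_singleton true)
    rw [show ({true}ᶜ : Set Bool) = {false} by ext b; cases b <;> simp] at this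
    rw [this, probReal_univ]; rfl
  rw [h1]; rfl

/-- `π_t` is the conditional probability of treatment given `H_t`. -/
lemma condExp_treatment [∀ t, Nonempty (X t)] (P : ProbabilityMeasure (Obs X)) (t : Fin T) :
    (P : Measure (Obs X))[fun z => ind (z.1.2 t) | restrAlg X (Set.Iic t) (Set.Iio t)]
      =ᵐ[(P : Measure (Obs X))] fun z => propensity P t z.1 := by
  have hm : Measurable (fun w : Traj X => ind (w.2 t)) := measurable_ind.comp (by fun_prop)
  have := condExp_hist (P := P) (t := t) (F := fun w : Traj X => ind (w.2 t)) hm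
    (fun w w' _ h2 => by simp [h2 t (Set.mem_Iic.2 le_rfl)])
    (Integrable.of_bound (hm.comp measurable_fst).aestronglyMeasurable 1
      (Eventually.of_forall fun z => by rcases ind_eq_zero_or_one (z.1.2 t) with h | h <;> simp [h]))
  refine this.trans (Eventually.of_forall fun z => ?_)
  simp [ind]

variable [∀ t, StandardBorelSpace (X t)] [∀ t, Nonempty (X t)]

/-- Conditional expectation given `(H_{t-1}, A_{t-1})` of a function of `H_t`. -/
lemma condExp_prev {t : Fin T} {F : Traj X → ℝ}
    (hF : Measurable F) (hd : DependsOnly (Set.Iic t) (Set.Iio t) F)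
    (hi : Integrable (fun z : Obs X => F z.1) (P : Measure (Obs X))) :
    (P : Measure (Obs X))[fun z => F z.1 | restrAlg X (Set.Iio t) (Set.Iio t)]
      =ᵐ[(P : Measure (Obs X))] fun z =>
        ∫ x, F (Function.update z.1.1 t x, z.1.2) ∂(covLaw P t z.1) := by
  set f : (((s : Set.Iio t) → X s) × (Set.Iio t → Bool)) × X t → ℝ := fun q =>
    F (Function.update (extend (Set.Iio t) (Set.Iio t) q.1).1 t q.2,
      (extend (Set.Iio t) (Set.Iio t) q.1).2) with hf
  have hfm : Measurable f := by
    have h1 : Measurable fun q : (((s : Set.Iio t) → X s) × (Set.Iio t → Bool)) × X t =>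
        extend (X := X) (Set.Iio t) (Set.Iio t) q.1 := (measurable_extend _ _).comp measurable_fst
    refine hF.comp (Measurable.prodMk (measurable_pi_lambda _ fun s => ?_) h1.snd)
    by_cases h : s = t
    · subst h; simpa using measurable_snd
    · simp only [Function.update_of_ne h]
      exact (measurable_pi_apply s).comp h1.fst
  have hfe : ∀ (z : Obs X) (x : X t), f (prev t z.1, x) =
      F (Function.update z.1.1 t x, z.1.2) := by
    intro z x
    refine hd _ _ (fun s hs => ?_) (fun s hs => extend_restr_snd z.1 hs)
    by_cases h : s = t
    · subst h; simp
    · simp only [Function.update_of_ne h]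
      exact extend_restr_fst (S := Set.Iio t) z.1 (lt_of_le_of_ne hs h)
  have hfe' : (fun z : Obs X => f (prev t z.1, z.1.1 t)) = fun z => F z.1 := by
    funext z; rw [hfe]; simp
  have hX : Measurable (fun z : Obs X => prev t z.1) :=
    (measurable_restr (Set.Iio t) (Set.Iio t)).comp measurable_fst
  have hY : Measurable (fun z : Obs X => z.1.1 t) := by fun_prop
  have key := condExp_prod_ae_eq_integral_condDistrib (μ := (P : Measure (Obs X))) hX
    hY.aemeasurable hfm.stronglyMeasurable (by rw [hfe']; exact hi)
  rw [hfe'] at key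
  refine key.trans (Eventually.of_forall fun z => ?_)
  simp only [hfe]
  rfl

end CondExp

end Incremental

namespace Incremental

section Weights

variable {T : ℕ} {X : Fin T → Type*} [∀ t, MeasurableSpace (X t)] {δ : ℝ}

lemma le_denom (P : ProbabilityMeasure (Obs X)) (t : Fin T) (w : Traj X) :
    min 1 δ ≤ denom δ P t w := by
  obtain ⟨h0, h1⟩ := propensity_mem_Icc P t w
  unfold denom
  rcases le_total 1 δ with h | h
  · rw [min_eq_left h]; nlinarith
  · rw [min_eq_right h]; nlinarith

lemma denom_pos (hδ : 0 < δ) (P : ProbabilityMeasure (Obs X)) (t : Fin T) (w : Traj X) :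
    0 < denom δ P t w :=
  (lt_min one_pos hδ).trans_le (le_denom P t w)

lemma measurable_denom (P : ProbabilityMeasure (Obs X)) (t : Fin T) :
    Measurable (denom δ P t) := by
  have := measurable_propensity P t
  unfold denom; fun_prop

lemma measurable_ind_treatment (t : Fin T) : Measurable (fun w : Traj X => ind (w.2 t)) :=
  measurable_ind.comp (by fun_prop)

lemma measurable_weight (P : ProbabilityMeasure (Obs X)) (t : Fin T) :
    Measurable (weight δ P t) := by
  have := measurable_denom (δ := δ) P t
  have := measurable_ind_treatment (X := X) t
  unfold weight; fun_prop

lemma measurable_intervention (P : ProbabilityMeasure (Obs X)) (t : Fin T) :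
    Measurable (intervention δ P t) := by
  have := measurable_denom (δ := δ) P t
  have := measurable_propensity P t
  have := measurable_ind_treatment (X := X) t
  unfold intervention; fun_prop

lemma abs_treatment_factor_le (hδ : 0 < δ) (b : Bool) : |δ * ind b + 1 - ind b| ≤ δ + 1 := by
  rcases ind_eq_zero_or_one b with h | h <;> rw [h, abs_le] <;> constructor <;> linarith

lemma abs_weight_le (hδ : 0 < δ) (P : ProbabilityMeasure (Obs X)) (t : Fin T) (w : Traj X) :
    |weight δ P t w| ≤ (δ + 1) / min 1 δ := by
  unfold weight
  rw [abs_div, abs_of_pos (denom_pos hδ P t w)]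
  exact div_le_div₀ (by linarith) (abs_treatment_factor_le hδ _) (lt_min one_pos hδ)
    (le_denom P t w)

lemma abs_prod_weight_le (hδ : 0 < δ) (P : ProbabilityMeasure (Obs X)) (S : Finset (Fin T))
    (w : Traj X) : |∏ s ∈ S, weight δ P s w| ≤ ((δ + 1) / min 1 δ) ^ S.card := by
  rw [Finset.abs_prod, ← Finset.prod_const]
  exact Finset.prod_le_prod (fun _ _ => abs_nonneg _) fun s _ => abs_weight_le hδ P s w

lemma measurable_prod_weight (P : ProbabilityMeasure (Obs X)) (S : Finset (Fin T)) :
    Measurable (fun w : Traj X => ∏ s ∈ S, weight δ P s w) :=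
  Finset.measurable_fun_prod S fun s _ => measurable_weight P s

lemma dependsOnly_denom (P : ProbabilityMeasure (Obs X)) (t : Fin T) :
    DependsOnly (Set.Iic t) (Set.Iio t) (denom δ P t) := fun w w' h1 h2 => by
  simp only [denom, dependsOnly_propensity P t w w' h1 h2]

lemma dependsOnly_weight (P : ProbabilityMeasure (Obs X)) (t : Fin T) :
    DependsOnly (Set.Iic t) (Set.Iic t) (weight δ P t) := fun w w' h1 h2 => by
  simp only [weight, h2 t (Set.mem_Iic.2 le_rfl),
    dependsOnly_denom P t w w' h1 fun s hs => h2 s (Set.Iio_subset_Iic_self hs)]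

lemma dependsOnly_intervention (P : ProbabilityMeasure (Obs X)) (t : Fin T) :
    DependsOnly (Set.Iic t) (Set.Iic t) (intervention δ P t) := fun w w' h1 h2 => by
  simp only [intervention, h2 t (Set.mem_Iic.2 le_rfl),
    dependsOnly_propensity P t w w' h1 fun s hs => h2 s (Set.Iio_subset_Iic_self hs),
    dependsOnly_denom P t w w' h1 fun s hs => h2 s (Set.Iio_subset_Iic_self hs)]

lemma integrable_prod_weight_mul (hδ : 0 < δ) {P : ProbabilityMeasure (Obs X)}
    (hY : Integrable (fun z : Obs X => z.2) (P : Measure (Obs X))) (S : Finset (Fin T)) :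
    Integrable (fun z : Obs X => (∏ s ∈ S, weight δ P s z.1) * z.2) (P : Measure (Obs X)) :=
  hY.bdd_mul ((measurable_prod_weight P S).comp measurable_fst).aestronglyMeasurable
    (Eventually.of_forall fun z => abs_prod_weight_le hδ P S z.1)

lemma measurable_outcomeReg (P : ProbabilityMeasure (Obs X)) : Measurable (outcomeReg P) := by
  have : StronglyMeasurable (fun w : Traj X => ∫ y, y ∂(condDistrib (fun z : Obs X => z.2)
      (fun z : Obs X => z.1) (P : Measure (Obs X)) w)) :=
    StronglyMeasurable.integral_kernel_prod_right' (f := fun p : Traj X × ℝ => p.2)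
      measurable_snd.stronglyMeasurable
  exact this.measurable

lemma measurable_update_treatment (t : Fin T) (b : Bool) :
    Measurable (fun w : Traj X => ((w.1, Function.update w.2 t b) : Traj X)) := by
  refine measurable_fst.prodMk (measurable_pi_lambda _ fun s => ?_)
  by_cases h : s = t
  · subst h; simp
  · simp only [Function.update_of_ne h]; fun_prop

lemma propensity_update (P : ProbabilityMeasure (Obs X)) (t : Fin T) (w : Traj X) (b : Bool) :
    propensity P t (w.1, Function.update w.2 t b) = propensity P t w :=
  dependsOnly_propensity P t _ _ (fun _ _ => rfl)
    fun _ hs => Function.update_of_ne (ne_of_lt hs) _ _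

end Weights

section PseudoRegression

variable {T : ℕ} {X : Fin T → Type*} [∀ t, MeasurableSpace (X t)]
  [∀ t, StandardBorelSpace (X t)] [∀ t, Nonempty (X t)] {δ : ℝ}

lemma integrateAfter_eq (P : ProbabilityMeasure (Obs X)) (t : Fin T) (F : Traj X → ℝ) :
    integrateAfter P t F = integrateTime P t (integrateAfter P (t + 1) F) := by
  unfold integrateAfter
  rw [List.drop_eq_getElem_cons (by simp), List.foldr_cons]
  simp

lemma integrateAfter_top (P : ProbabilityMeasure (Obs X)) (F : Traj X → ℝ) :
    integrateAfter P T F = F := by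
  unfold integrateAfter
  rw [List.drop_eq_nil_of_le (by simp)]
  rfl

lemma integrateTime_mul (P : ProbabilityMeasure (Obs X)) (t : Fin T) {c : Traj X → ℝ}
    (hc : DependsOnly (Set.Iio t) (Set.Iio t) c) (G : Traj X → ℝ) :
    integrateTime P t (fun w => c w * G w) = fun w => c w * integrateTime P t G w := by
  funext w
  unfold integrateTime
  rw [← integral_const_mul]
  congr 1; funext x
  rw [Finset.mul_sum]
  refine Finset.sum_congr rfl fun b _ => ?_
  beta_reduce
  rw [hc (Function.update w.1 t x, Function.update w.2 t b) w
    (fun s hs => Function.update_of_ne (ne_of_lt hs) _ _)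
    fun s hs => Function.update_of_ne (ne_of_lt hs) _ _]

lemma integrateAfter_mul (P : ProbabilityMeasure (Obs X)) (n t : ℕ) (hn : t + n = T)
    {c : Traj X → ℝ} (hc : DependsOnly {s : Fin T | (s : ℕ) < t} {s : Fin T | (s : ℕ) < t} c)
    (F : Traj X → ℝ) :
    integrateAfter P t (fun w => c w * F w) = fun w => c w * integrateAfter P t F w := by
  induction n generalizing t with
  | zero =>
    obtain rfl : t = T := by omega
    simp only [integrateAfter_top]
  | succ n ih =>
    have ht : t < T := by omega
    have h1 := integrateAfter_eq P ⟨t, ht⟩ (fun w => c w * F w)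
    have h2 := integrateAfter_eq P ⟨t, ht⟩ F
    simp only at h1 h2
    rw [h1, h2, ih (t + 1) (by omega) (hc.mono (fun s hs => Nat.lt_succ_of_lt hs)
      (fun s hs => Nat.lt_succ_of_lt hs))]
    exact integrateTime_mul P ⟨t, ht⟩ hc _

lemma dependsOnly_pseudoReg (P : ProbabilityMeasure (Obs X)) {t : ℕ} (ht : t ≤ T) :
    DependsOnly {s : Fin T | (s : ℕ) < t} {s : Fin T | (s : ℕ) < t} (pseudoReg δ P t) :=
  fun w w' h1 h2 => integrateAfter_congr P _ (T - t) t (by omega) w w' h1 h2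

lemma setOf_lt_succ (t : Fin T) : {s : Fin T | (s : ℕ) < t + 1} = Set.Iic t := by
  ext s
  simp

lemma filter_le_eq_insert (t : Fin T) :
    Finset.univ.filter (fun s : Fin T => (t : ℕ) ≤ s) =
      insert t (Finset.univ.filter (fun s : Fin T => (t : ℕ) + 1 ≤ s)) := by
  ext s
  simp only [Finset.mem_filter, Finset.mem_univ, true_and, Finset.mem_insert, Fin.ext_iff]
  omega

lemma notMem_filter_succ_le (t : Fin T) :
    t ∉ Finset.univ.filter (fun s : Fin T => (t : ℕ) + 1 ≤ s) := by
  simp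

/-- Recursion for the pseudo-regressions. -/
lemma pseudoReg_eq (P : ProbabilityMeasure (Obs X)) (t : Fin T) :
    pseudoReg δ P t =
      integrateTime P t (fun w => intervention δ P t w * pseudoReg δ P (t + 1) w) := by
  have h : DependsOnly {s : Fin T | (s : ℕ) < t + 1} {s : Fin T | (s : ℕ) < t + 1}
      (intervention δ P t) := by
    rw [setOf_lt_succ]; exact dependsOnly_intervention P t
  unfold pseudoReg
  rw [integrateAfter_eq, ← integrateAfter_mul P (T - (t + 1)) (t + 1) (by have := t.2; omega) h]
  congr 2
  funext w
  rw [filter_le_eq_insert, Finset.prod_insert (notMem_filter_succ_le t)]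
  ring

lemma measurable_integrateTime (P : ProbabilityMeasure (Obs X)) (t : Fin T) {G : Traj X → ℝ}
    (hG : Measurable G) : Measurable (integrateTime P t G) := by
  set κ : Kernel (Traj X) (X t) := (condDistrib (fun z : Obs X => z.1.1 t)
    (fun z : Obs X => prev t z.1) (P : Measure (Obs X))).comap (prev t)
    (measurable_restr (Set.Iio t) (Set.Iio t)) with hκ
  have h1 : Measurable (fun q : Traj X × X t =>
      ∑ b : Bool, G (Function.update q.1.1 t q.2, Function.update q.1.2 t b)) := by
    refine Finset.measurable_fun_sum _ fun b _ => hG.comp (Measurable.prodMk ?_ ?_)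
    · refine measurable_pi_lambda _ fun s => ?_
      by_cases h : s = t
      · subst h; simpa using measurable_snd
      · simp only [Function.update_of_ne h]; fun_prop
    · refine measurable_pi_lambda _ fun s => ?_
      by_cases h : s = t
      · subst h; simp
      · simp only [Function.update_of_ne h]; fun_prop
  have : IsMarkovKernel κ := Kernel.IsMarkovKernel.comap _ _
  have h2 := StronglyMeasurable.integral_kernel_prod_right' (κ := κ) h1.stronglyMeasurable
  exact h2.measurable

lemma measurable_integrateAfter (P : ProbabilityMeasure (Obs X)) (t : ℕ) {F : Traj X → ℝ}
    (hF : Measurable F) : Measurable (integrateAfter P t F) := by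
  unfold integrateAfter
  induction (List.finRange T).drop t with
  | nil => exact hF
  | cons s l ih => exact measurable_integrateTime P s ih

lemma measurable_pseudoReg (P : ProbabilityMeasure (Obs X)) (t : ℕ) :
    Measurable (pseudoReg δ P t) :=
  measurable_integrateAfter P t ((measurable_outcomeReg P).mul
    (Finset.measurable_fun_prod _ fun s _ => measurable_intervention P s))

/-- The regression of the weighted pseudo-outcome at time `t` on the history `H_t`. -/
noncomputable def histReg (δ : ℝ) (P : ProbabilityMeasure (Obs X)) (t : Fin T) (w : Traj X) : ℝ :=
  (δ * propensity P t w * pseudoReg δ P (t + 1) (w.1, Function.update w.2 t true)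
    + (1 - propensity P t w) * pseudoReg δ P (t + 1) (w.1, Function.update w.2 t false)) /
      denom δ P t w

lemma measurable_histReg (P : ProbabilityMeasure (Obs X)) (t : Fin T) :
    Measurable (histReg δ P t) := by
  have h1 := (measurable_pseudoReg (δ := δ) P (t + 1)).comp (measurable_update_treatment t true)
  have h2 := (measurable_pseudoReg (δ := δ) P (t + 1)).comp (measurable_update_treatment t false)
  have h3 := measurable_propensity P t
  exact ((((h3.const_mul δ).mul h1).add ((h3.const_sub 1).mul h2)).div (measurable_denom P t))

lemma dependsOnly_histReg (P : ProbabilityMeasure (Obs X)) (t : Fin T) :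
    DependsOnly (Set.Iic t) (Set.Iio t) (histReg δ P t) := by
  intro w w' h1 h2
  have h : ∀ b, pseudoReg δ P (t + 1) (w.1, Function.update w.2 t b) =
      pseudoReg δ P (t + 1) (w'.1, Function.update w'.2 t b) := fun b => by
    have hd := dependsOnly_pseudoReg (δ := δ) P (t := t + 1) t.2
    rw [setOf_lt_succ] at hd
    refine hd _ _ h1 fun s hs => ?_
    by_cases hst : s = t
    · subst hst; simp
    · simp only [Function.update_of_ne hst]
      exact h2 s (lt_of_le_of_ne hs hst)
  simp only [histReg, h, dependsOnly_propensity P t w w' h1 h2, dependsOnly_denom P t w w' h1 h2]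

lemma pseudoReg_eq_integral_histReg (P : ProbabilityMeasure (Obs X)) (t : Fin T) (w : Traj X) :
    pseudoReg δ P t w =
      ∫ x, histReg δ P t (Function.update w.1 t x, w.2) ∂(covLaw P t w) := by
  rw [pseudoReg_eq, integrateTime]
  congr 1; funext x
  have h := propensity_update P t (Function.update w.1 t x, w.2)
  simp only at h
  simp only [Fintype.sum_bool, intervention, histReg, denom, h, Function.update_self, ind]
  simp
  ring

/-- The pseudo-regressions are the conditional expectations of the weighted outcome. -/
lemma condExp_weighted (hδ : 0 < δ) {P : ProbabilityMeasure (Obs X)}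
    (hY : Integrable (fun z : Obs X => z.2) (P : Measure (Obs X))) {t : Fin T}
    (hnext : (P : Measure (Obs X))[fun z =>
        (∏ s ∈ Finset.univ.filter (fun s : Fin T => (t : ℕ) + 1 ≤ s), weight δ P s z.1) * z.2 |
          restrAlg X (Set.Iic t) (Set.Iic t)]
      =ᵐ[(P : Measure (Obs X))] fun z => pseudoReg δ P (t + 1) z.1) :
    (P : Measure (Obs X))[fun z =>
        (∏ s ∈ Finset.univ.filter (fun s : Fin T => (t : ℕ) ≤ s), weight δ P s z.1) * z.2 |
          restrAlg X (Set.Iic t) (Set.Iio t)]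
      =ᵐ[(P : Measure (Obs X))] fun z => histReg δ P t z.1 := by
  set μ := (P : Measure (Obs X))
  set V : Obs X → ℝ := fun z =>
    (∏ s ∈ Finset.univ.filter (fun s : Fin T => (t : ℕ) + 1 ≤ s), weight δ P s z.1) * z.2 with hV
  have hVi : Integrable V μ := integrable_prod_weight_mul hδ hY _
  have e1 : (fun z : Obs X =>
      (∏ s ∈ Finset.univ.filter (fun s : Fin T => (t : ℕ) ≤ s), weight δ P s z.1) * z.2) =
      (fun z => weight δ P t z.1) * V := by
    funext z
    rw [filter_le_eq_insert, Finset.prod_insert (notMem_filter_succ_le t)]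
    simp only [hV, Pi.mul_apply]; ring
  have hwi : Integrable ((fun z => weight δ P t z.1) * V) μ := by
    rw [← e1]; exact integrable_prod_weight_mul hδ hY _
  have hle : restrAlg X (Set.Iic t) (Set.Iio t) ≤ restrAlg X (Set.Iic t) (Set.Iic t) :=
    restrAlg_mono le_rfl Set.Iio_subset_Iic_self
  have e2 : μ[(fun z => weight δ P t z.1) * V | restrAlg X (Set.Iic t) (Set.Iic t)] =ᵐ[μ]
      fun z => weight δ P t z.1 * pseudoReg δ P (t + 1) z.1 := by
    refine (condExp_mul_of_stronglyMeasurable_left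
      ((dependsOnly_weight P t).stronglyMeasurable (measurable_weight P t)) hwi hVi).trans ?_
    filter_upwards [hnext] with z hz
    simp only [Pi.mul_apply, hz]
  rw [e1]
  have hd := dependsOnly_pseudoReg (δ := δ) P (t := t + 1) t.2
  rw [setOf_lt_succ] at hd
  have e3 := condExp_hist (P := P) (t := t)
    (F := fun w => weight δ P t w * pseudoReg δ P (t + 1) w)
    ((measurable_weight P t).mul (measurable_pseudoReg P (t + 1)))
    (fun w w' h1 h2 => by beta_reduce; rw [dependsOnly_weight P t w w' h1 h2, hd w w' h1 h2])
    (integrable_condExp.congr e2)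
  refine (condExp_condExp_of_le hle (restrAlg_le _ _)).symm.trans
    ((condExp_congr_ae e2).trans (e3.trans (Eventually.of_forall fun z => ?_)))
  have h := propensity_update P t z.1
  simp only [weight, histReg, denom, h, Function.update_self, ind]
  simp
  ring

theorem condExp_weighted_past (hδ : 0 < δ) {P : ProbabilityMeasure (Obs X)}
    (hY : Integrable (fun z : Obs X => z.2) (P : Measure (Obs X))) (n t : ℕ) (hn : t + n = T) :
    (P : Measure (Obs X))[fun z =>
        (∏ s ∈ Finset.univ.filter (fun s : Fin T => t ≤ (s : ℕ)), weight δ P s z.1) * z.2 |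
          restrAlg X {s : Fin T | (s : ℕ) < t} {s : Fin T | (s : ℕ) < t}]
      =ᵐ[(P : Measure (Obs X))] fun z => pseudoReg δ P t z.1 := by
  induction n generalizing t with
  | zero =>
    obtain rfl : t = T := by omega
    have he : Finset.univ.filter (fun s : Fin t => t ≤ (s : ℕ)) = ∅ := by
      ext s; simp
    have hr : pseudoReg δ P t = outcomeReg P := by
      unfold pseudoReg
      rw [integrateAfter_top, he]
      simp
    rw [restrAlg_univ (S := {s : Fin t | (s : ℕ) < t}) (S' := {s : Fin t | (s : ℕ) < t})
      (fun s => s.2) (fun s => s.2), hr]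
    simp only [he, Finset.prod_empty, one_mul]
    exact condExp_ae_eq_integral_condDistrib' measurable_fst hY
  | succ n ih =>
    have ht : t < T := by omega
    have h1 := ih (t + 1) (by omega)
    have h2 := condExp_weighted hδ hY (t := ⟨t, ht⟩) (by
      rw [← setOf_lt_succ]; exact h1)
    have hle : restrAlg X (Set.Iio ⟨t, ht⟩) (Set.Iio ⟨t, ht⟩) ≤
        restrAlg X (Set.Iic ⟨t, ht⟩) (Set.Iio ⟨t, ht⟩) :=
      restrAlg_mono Set.Iio_subset_Iic_self le_rfl
    have h3 := condExp_prev (P := P) (t := ⟨t, ht⟩) (measurable_histReg (δ := δ) P ⟨t, ht⟩)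
      (dependsOnly_histReg P _) (integrable_condExp.congr h2)
    have h4 := (condExp_condExp_of_le hle (restrAlg_le _ _)).symm.trans
      ((condExp_congr_ae h2).trans h3)
    refine EventuallyEq.trans h4 (Eventually.of_forall fun z => ?_)
    exact (pseudoReg_eq_integral_histReg P ⟨t, ht⟩ z.1).symm

theorem condExp_weighted_hist (hδ : 0 < δ) {P : ProbabilityMeasure (Obs X)}
    (hY : Integrable (fun z : Obs X => z.2) (P : Measure (Obs X))) (t : Fin T) :
    (P : Measure (Obs X))[fun z => (∏ s : Fin T, weight δ P s z.1) * z.2 |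
        restrAlg X (Set.Iic t) (Set.Iio t)]
      =ᵐ[(P : Measure (Obs X))] fun z =>
        (∏ s ∈ Finset.Iio t, weight δ P s z.1) * histReg δ P t z.1 := by
  have h1 := condExp_weighted_past hδ hY (T - (t + 1)) (t + 1) (by have := t.2; omega)
  rw [setOf_lt_succ] at h1
  have h2 := condExp_weighted hδ hY h1
  have e : (fun z : Obs X => (∏ s : Fin T, weight δ P s z.1) * z.2) =
      (fun z => ∏ s ∈ Finset.Iio t, weight δ P s z.1) * fun z =>
        (∏ s ∈ Finset.univ.filter (fun s : Fin T => (t : ℕ) ≤ s), weight δ P s z.1) * z.2 := by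
    funext z
    simp only [Pi.mul_apply]
    rw [← mul_assoc]
    congr 1
    rw [← Finset.prod_filter_mul_prod_filter_not Finset.univ (fun s : Fin T => (s : ℕ) < t)]
    congr 1
    · refine Finset.prod_congr ?_ fun _ _ => rfl
      ext s; simp
    · refine Finset.prod_congr ?_ fun _ _ => rfl
      ext s; simp
  rw [e]
  have hd : DependsOnly (Set.Iic t) (Set.Iio t)
      (fun w : Traj X => ∏ s ∈ Finset.Iio t, weight δ P s w) := fun w w' g1 g2 => by
    refine Finset.prod_congr rfl fun s hs => ?_
    have hs' : s < t := Finset.mem_Iio.1 hs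
    exact dependsOnly_weight P s w w' (fun i hi => g1 i (le_trans hi hs'.le))
      fun i hi => g2 i (lt_of_le_of_lt hi hs')
  refine (condExp_mul_of_stronglyMeasurable_left
    (hd.stronglyMeasurable (measurable_prod_weight P _)) ?_
    (integrable_prod_weight_mul hδ hY _)).trans ?_
  · rw [← e]; exact integrable_prod_weight_mul hδ hY _
  · filter_upwards [h2] with z hz
    simp only [Pi.mul_apply, hz]

/-- The incremental effect is the expectation of the inverse-probability weighted outcome. -/
theorem effect_eq_integral (hδ : 0 < δ) {P : ProbabilityMeasure (Obs X)}
    (hY : Integrable (fun z : Obs X => z.2) (P : Measure (Obs X))) :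
    effect δ P = ∫ z, (∏ s : Fin T, weight δ P s z.1) * z.2 ∂(P : Measure (Obs X)) := by
  have h := condExp_weighted_past hδ hY T 0 (by omega)
  have h2 := integral_condExp (μ := (P : Measure (Obs X))) (f := fun z : Obs X =>
    (∏ s ∈ Finset.univ.filter (fun s : Fin T => 0 ≤ (s : ℕ)), weight δ P s z.1) * z.2)
    (restrAlg_le {s : Fin T | (s : ℕ) < 0} {s : Fin T | (s : ℕ) < 0})
  rw [integral_congr_ae h] at h2
  simpa [pseudoReg_zero_eq] using h2

end PseudoRegression

end Incremental

namespace Efficiency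

/-- Self-adjointness of the conditional expectation. -/
lemma integral_condExp_mul_comm {Z : Type*} {mZ : MeasurableSpace Z} {μ : Measure Z} [IsFiniteMeasure μ]
    {m : MeasurableSpace Z} (hm : m ≤ mZ) {u v : Z → ℝ} (hu : MemLp u 2 μ)
    (hv : MemLp v 2 μ) : ∫ z, (μ[u | m]) z * v z ∂μ = ∫ z, u z * (μ[v | m]) z ∂μ := by
  have key : ∀ {u v : Z → ℝ}, MemLp u 2 μ → MemLp v 2 μ →
      ∫ z, (μ[u | m]) z * v z ∂μ = ∫ z, (μ[u | m]) z * (μ[v | m]) z ∂μ := by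
    intro u v hu hv
    have hcu : MemLp (μ[u | m]) 2 μ := hu.condExp (by norm_num)
    have h := condExp_mul_of_stronglyMeasurable_left (μ := μ) (m := m) (f := μ[u | m]) (g := v)
      stronglyMeasurable_condExp (hcu.integrable_mul hv) (hv.integrable (by norm_num))
    have h2 := integral_condExp (μ := μ) (f := μ[u | m] * v) hm
    rw [integral_congr_ae h] at h2
    exact h2.symm
  rw [key hu hv]
  have := key hv hu
  calc _ = ∫ z, (μ[v | m]) z * (μ[u | m]) z ∂μ := by simp_rw [mul_comm]
    _ = _ := this.symm
    _ = _ := by simp_rw [mul_comm]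

section Tangent

variable {Z : Type*} [MeasurableSpace Z]

lemma abs_sqrt_one_add_sub_le {x : ℝ} (hx : -1 ≤ x) : |√(1 + x) - 1 - x / 2| ≤ x ^ 2 / 2 := by
  set s := √(1 + x)
  have hs : 0 ≤ s := Real.sqrt_nonneg _
  have hs2 : s ^ 2 = 1 + x := Real.sq_sqrt (by linarith)
  have e : s - 1 - x / 2 = -((s - 1) ^ 2 / 2) := by nlinarith
  have e2 : x = (s - 1) * (s + 1) := by nlinarith
  rw [e, abs_neg, abs_of_nonneg (by positivity), e2, mul_pow]
  have : 1 ≤ (s + 1) ^ 2 := by nlinarith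
  nlinarith [sq_nonneg (s - 1)]

open Classical in
/-- The model with densities `1 + ε h` with respect to `P` for small `ε`. -/
noncomputable def tilt (P : ProbabilityMeasure Z) (h : Z → ℝ) (ε : ℝ) : ProbabilityMeasure Z :=
  if H : IsProbabilityMeasure ((P : Measure Z).withDensity fun z => ENNReal.ofReal (1 + ε * h z))
  then ⟨_, H⟩ else P

lemma tilt_coe {P : ProbabilityMeasure Z} {h : Z → ℝ} (hm : Measurable h) {K : ℝ}
    (hK : ∀ z, |h z| ≤ K) (h0 : ∫ z, h z ∂(P : Measure Z) = 0) {ε : ℝ} (hε : |ε| * K ≤ 1) :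
    (tilt P h ε : Measure Z) =
      (P : Measure Z).withDensity fun z => ENNReal.ofReal (1 + ε * h z) := by
  have hi : Integrable h (P : Measure Z) :=
    Integrable.of_bound hm.aestronglyMeasurable K (Eventually.of_forall hK)
  have hnn : ∀ z, 0 ≤ 1 + ε * h z := fun z => by
    have : |ε * h z| ≤ 1 := by
      rw [abs_mul]
      exact (mul_le_mul_of_nonneg_left (hK z) (abs_nonneg _)).trans hε
    linarith [(abs_le.1 this).1]
  have H : IsProbabilityMeasure
      ((P : Measure Z).withDensity fun z => ENNReal.ofReal (1 + ε * h z)) := by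
    refine ⟨?_⟩
    have hi' : Integrable (fun z => 1 + ε * h z) (P : Measure Z) :=
      (integrable_const 1).add (hi.const_mul ε)
    rw [withDensity_apply _ MeasurableSet.univ, Measure.restrict_univ,
      ← ofReal_integral_eq_lintegral_ofReal hi' (Eventually.of_forall hnn),
      integral_add (integrable_const 1) (hi.const_mul ε), integral_const_mul, h0]
    simp
  simp [tilt, H]

lemma isSubmodel_tilt {P : ProbabilityMeasure Z} {h : Z → ℝ} (hm : Measurable h) {K : ℝ}
    (hK : ∀ z, |h z| ≤ K) (h0 : ∫ z, h z ∂(P : Measure Z) = 0) :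
    IsSubmodel P (tilt P h) h := by
  refine ⟨?_, MemLp.of_bound hm.aestronglyMeasurable K (Eventually.of_forall hK),
    (P : Measure Z), inferInstance, ?_, ?_⟩
  · apply Subtype.ext
    have := tilt_coe hm hK h0 (ε := 0) (by simp)
    refine this.trans ?_
    simp
  · intro ε
    by_cases H : IsProbabilityMeasure
        ((P : Measure Z).withDensity fun z => ENNReal.ofReal (1 + ε * h z))
    · simpa [tilt, H] using withDensity_absolutelyContinuous _ _
    · simpa [tilt, H] using Measure.AbsolutelyContinuous.refl _
  · have hsmall : ∀ᶠ ε : ℝ in 𝓝[≠] 0, |ε| * K ≤ 1 := by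
      have : Tendsto (fun ε : ℝ => |ε| * K) (𝓝 0) (𝓝 (|0| * K)) :=
        (continuous_abs.tendsto 0).mul_const _
      simp only [abs_zero, zero_mul] at this
      exact (this.eventually_le_const one_pos).filter_mono nhdsWithin_le_nhds
    have hlim : Tendsto (fun ε : ℝ => ENNReal.ofReal (|ε| * (K ^ 2 / 2))) (𝓝[≠] 0) (𝓝 0) := by
      have : Tendsto (fun ε : ℝ => ENNReal.ofReal (|ε| * (K ^ 2 / 2))) (𝓝 0)
          (𝓝 (ENNReal.ofReal (|0| * (K ^ 2 / 2)))) :=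
        ENNReal.tendsto_ofReal ((continuous_abs.tendsto 0).mul_const _)
      simp only [abs_zero, zero_mul, ENNReal.ofReal_zero] at this
      exact this.mono_left nhdsWithin_le_nhds
    refine tendsto_of_tendsto_of_tendsto_of_le_of_le' tendsto_const_nhds hlim
      (Eventually.of_forall fun _ => zero_le) ?_
    filter_upwards [hsmall, self_mem_nhdsWithin] with ε hε hne
    have hε0 : ε ≠ 0 := hne
    have hd1 : ∀ᵐ z ∂(P : Measure Z), density P (P : Measure Z) z = 1 := by
      filter_upwards [Measure.rnDeriv_self (P : Measure Z)] with z hz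
      simp [density, hz]
    have hd2 : ∀ᵐ z ∂(P : Measure Z), density (tilt P h ε) (P : Measure Z) z = 1 + ε * h z := by
      have hmd : Measurable fun z => ENNReal.ofReal (1 + ε * h z) := by fun_prop
      filter_upwards [Measure.rnDeriv_withDensity (P : Measure Z) hmd] with z hz
      unfold density
      rw [tilt_coe hm hK h0 hε, hz, ENNReal.toReal_ofReal]
      have : |ε * h z| ≤ 1 := by
        rw [abs_mul]
        exact (mul_le_mul_of_nonneg_left (hK z) (abs_nonneg _)).trans hε
      linarith [(abs_le.1 this).1]
    have hb := eLpNorm_le_of_ae_bound (p := 2) (μ := (P : Measure Z)) (C := |ε| * (K ^ 2 / 2))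
      (f := fun z => (√(density (tilt P h ε) (P : Measure Z) z) - √(density P (P : Measure Z) z))
        / ε - h z / 2 * √(density P (P : Measure Z) z)) (by
      filter_upwards [hd1, hd2] with z h1 h2
      rw [h1, h2, Real.sqrt_one, mul_one, Real.norm_eq_abs]
      have hx : |ε * h z| ≤ 1 := by
        rw [abs_mul]
        exact (mul_le_mul_of_nonneg_left (hK z) (abs_nonneg _)).trans hε
      have h3 := abs_sqrt_one_add_sub_le (abs_le.1 hx).1
      have e : (√(1 + ε * h z) - 1) / ε - h z / 2 =
          (√(1 + ε * h z) - 1 - ε * h z / 2) / ε := by field_simp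
      rw [e, abs_div, div_le_iff₀ (abs_pos.2 hε0)]
      refine h3.trans ?_
      have h4 : (ε * h z) ^ 2 ≤ |ε| ^ 2 * K ^ 2 := by
        rw [← sq_abs (ε * h z), abs_mul, mul_pow]
        exact mul_le_mul_of_nonneg_left (pow_le_pow_left₀ (abs_nonneg _) (hK z) 2) (by positivity)
      nlinarith)
    simpa using hb

/-- Bounded mean-zero functions are dense among the mean-zero functions in `L²`. -/
lemma exists_bounded_mean_zero {P : ProbabilityMeasure Z} {φ : Z → ℝ}
    (hφ : MemLp φ 2 (P : Measure Z)) (hφ0 : ∫ z, φ z ∂(P : Measure Z) = 0) {η : ℝ≥0∞}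
    (hη : 0 < η) :
    ∃ h : Z → ℝ, Measurable h ∧ (∃ K, ∀ z, |h z| ≤ K) ∧
      ∫ z, h z ∂(P : Measure Z) = 0 ∧ eLpNorm (fun z => φ z - h z) 2 (P : Measure Z) < η := by
  have hη2 : η / 2 ≠ 0 := (ENNReal.half_pos hη.ne').ne'
  obtain ⟨s, hs, hsm⟩ := hφ.exists_simpleFunc_eLpNorm_sub_lt (by norm_num) hη2
  obtain ⟨C, hC⟩ := s.exists_forall_norm_le
  have hsi : Integrable s (P : Measure Z) := hsm.integrable (by norm_num)
  have hφi : Integrable φ (P : Measure Z) := hφ.integrable (by norm_num)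
  set c := ∫ z, s z ∂(P : Measure Z) with hc
  refine ⟨fun z => s z - c, s.measurable.sub_const c, ⟨C + |c|, fun z => ?_⟩,
    ?_, ?_⟩
  · have h1 := abs_sub (s z) c
    have h2 := hC z
    rw [Real.norm_eq_abs] at h2
    linarith
  · rw [integral_sub hsi (integrable_const c)]
    simp [hc]
  · have hc2 : ‖c‖ₑ ≤ eLpNorm (φ - ⇑s) 2 (P : Measure Z) := by
      have e : c = - ∫ z, (φ - ⇑s) z ∂(P : Measure Z) := by
        simp only [Pi.sub_apply]
        rw [integral_sub hφi hsi, hφ0, hc]; ring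
      rw [e, enorm_neg]
      refine (enorm_integral_le_lintegral_enorm _).trans ?_
      rw [← eLpNorm_one_eq_lintegral_enorm]
      exact eLpNorm_le_eLpNorm_of_exponent_le (by norm_num) (hφ.1.sub hsm.1)
    have e : (fun z => φ z - (s z - c)) = (φ - ⇑s) + fun _ => c := by
      funext z; simp; ring
    rw [e]
    calc _ ≤ eLpNorm (φ - ⇑s) 2 (P : Measure Z) + eLpNorm (fun _ => c) 2 (P : Measure Z) :=
          eLpNorm_add_le (hφ.1.sub hsm.1) aestronglyMeasurable_const (by norm_num)
      _ ≤ eLpNorm (φ - ⇑s) 2 (P : Measure Z) + eLpNorm (φ - ⇑s) 2 (P : Measure Z) := by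
          gcongr
          rw [eLpNorm_const c (by norm_num) (NeZero.ne _)]
          simpa using hc2
      _ < η / 2 + η / 2 := ENNReal.add_lt_add hs hs
      _ = η := ENNReal.add_halves η

end Tangent

end Efficiency

namespace Incremental

open Efficiency

section Submodels

variable {T : ℕ} {X : Fin T → Type*} [∀ t, MeasurableSpace (X t)]

lemma submodel_tilt {P : ProbabilityMeasure (Obs X)}
    (hY : MemLp (fun z : Obs X => z.2) 2 (P : Measure (Obs X))) {h : Obs X → ℝ}
    (hm : Measurable h) {K : ℝ} (hK : ∀ z, |h z| ≤ K)
    (h0 : ∫ z, h z ∂(P : Measure (Obs X)) = 0) : Submodel P (tilt P h) h := by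
  refine ⟨isSubmodel_tilt hm hK h0, ?_⟩
  set I := ∫⁻ z, ‖z.2‖ₑ ^ 2 ∂(P : Measure (Obs X)) with hI
  have hfin : I < ∞ := by
    have := lintegral_rpow_enorm_lt_top_of_eLpNorm_lt_top (by norm_num) (by norm_num) hY.2
    simpa [hI] using this
  refine ⟨(2 * I).toNNReal, ?_⟩
  have hsmall : ∀ᶠ ε : ℝ in 𝓝 0, |ε| * K ≤ 1 := by
    have : Tendsto (fun ε : ℝ => |ε| * K) (𝓝 0) (𝓝 (|0| * K)) :=
      (continuous_abs.tendsto 0).mul_const _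
    simp only [abs_zero, zero_mul] at this
    exact this.eventually_le_const one_pos
  filter_upwards [hsmall] with ε hε
  rw [ENNReal.coe_toNNReal (ENNReal.mul_ne_top (by norm_num) hfin.ne), tilt_coe hm hK h0 hε,
    lintegral_withDensity_eq_lintegral_mul _ (by fun_prop) (by fun_prop), hI,
    ← lintegral_const_mul _ (by fun_prop)]
  refine lintegral_mono fun z => ?_
  simp only [Pi.mul_apply]
  gcongr
  rw [show (2 : ℝ≥0∞) = ENNReal.ofReal 2 by norm_num]
  refine ENNReal.ofReal_le_ofReal ?_
  have hx : |ε * h z| ≤ 1 := by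
    rw [abs_mul]
    exact (mul_le_mul_of_nonneg_left (hK z) (abs_nonneg _)).trans hε
  linarith [(abs_le.1 hx).2]

/-- Two functions which both represent the derivative of a parameter agree almost everywhere. -/
lemma isEIF_unique {P : ProbabilityMeasure (Obs X)}
    (hY : MemLp (fun z : Obs X => z.2) 2 (P : Measure (Obs X)))
    {Ψ : ProbabilityMeasure (Obs X) → ℝ} {φ₁ φ₂ : Obs X → ℝ}
    (h₁ : IsEIF (Submodel P) Ψ P φ₁) (h₂ : IsEIF (Submodel P) Ψ P φ₂) :
    φ₁ =ᵐ[(P : Measure (Obs X))] φ₂ := by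
  have i1 := h₁.memLp.integrable (q := 2) (by norm_num)
  have i2 := h₂.memLp.integrable (q := 2) (by norm_num)
  refine Integrable.ae_eq_of_forall_setIntegral_eq _ _ i1 i2 fun s hs _ => ?_
  set c := (P : Measure (Obs X)).real s with hc
  set h : Obs X → ℝ := fun z => s.indicator (fun _ => (1 : ℝ)) z - c with hh
  have hhm : Measurable h := (measurable_const.indicator hs).sub_const c
  have hc1 : 0 ≤ c ∧ c ≤ 1 := ⟨measureReal_nonneg, measureReal_le_one⟩
  have hhK : ∀ z, |h z| ≤ 1 := fun z => by
    simp only [hh]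
    by_cases hz : z ∈ s
    · rw [Set.indicator_of_mem hz, abs_le]; constructor <;> linarith [hc1.1, hc1.2]
    · rw [Set.indicator_of_notMem hz, abs_le]; constructor <;> linarith [hc1.1, hc1.2]
  have hh0 : ∫ z, h z ∂(P : Measure (Obs X)) = 0 := by
    simp only [hh]
    rw [integral_sub ((integrable_const 1).indicator hs) (integrable_const c),
      integral_indicator_const _ hs]
    simp [hc]
  have hS := submodel_tilt hY hhm hhK hh0
  have hd := (h₁.pathwise _ _ hS).unique (h₂.pathwise _ _ hS)
  have key : ∀ {φ : Obs X → ℝ}, Integrable φ (P : Measure (Obs X)) →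
      ∫ z, φ z ∂(P : Measure (Obs X)) = 0 →
      ∫ z, φ z * h z ∂(P : Measure (Obs X)) = ∫ z in s, φ z ∂(P : Measure (Obs X)) := by
    intro φ hi h0
    have e : (fun z => φ z * h z) = fun z => s.indicator φ z - φ z * c := by
      funext z
      by_cases hz : z ∈ s
      · simp [hh, hz]; ring
      · simp [hh, hz]
    rw [e, integral_sub (hi.indicator hs) (hi.mul_const c), integral_indicator hs,
      integral_mul_const, h0]
    simp
  rw [← key i1 h₁.mean_zero, ← key i2 h₂.mean_zero, hd]

end Submodels

end Incremental

namespace Efficiency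

namespace RootModel

variable {Z : Type*} {m : MeasurableSpace Z} [mZ : MeasurableSpace Z] {ν : Measure Z}
  {r : ℝ → Z → ℝ} {Q : ℝ → ProbabilityMeasure Z} {g : Z → ℝ}

lemma HasL2Deriv.affine (M : RootModel ν r Q g) {k : ℝ → Z → ℝ} {k' : Z → ℝ}
    (hk : HasL2Deriv ν r k k') (a b : ℝ) :
    HasL2Deriv ν r (fun ε z => a + b * k ε z) (fun z => b * k' z) := by
  have h := (HasL2Deriv.const (ν := ν) (r := r) (k := fun _ : Z => b) measurable_const
    (C := |b|) fun _ => le_rfl).mul M hk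
  obtain ⟨C, hC, hb⟩ := h.bounded
  have h' := h.congr_deriv (k'' := fun z => b * k' z) fun z => by simp
  refine ⟨fun ε => measurable_const.add (h.measurable ε), ⟨|a| + C, by positivity, fun ε z =>
    (abs_add_le _ _).trans (add_le_add le_rfl (hb ε z))⟩, h'.measurable_deriv, h'.memLp_deriv,
    h'.tendsto.congr' (Eventually.of_forall fun ε z => ?_)⟩
  ring

lemma hasL2Deriv_condExp (M : RootModel ν r Q g) (hm : m ≤ mZ) {A : Z → ℝ} {p : ℝ → Z → ℝ}
    (hA : Measurable A) (hA01 : ∀ z, A z ∈ Set.Icc (0 : ℝ) 1)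
    (hpA : ∀ ε, (Q ε : Measure Z)[A | m] =ᵐ[(Q ε : Measure Z)] p ε)
    (hp : ∀ ε, StronglyMeasurable[m] (p ε)) (hp01 : ∀ ε z, p ε z ∈ Set.Icc (0 : ℝ) 1) :
    HasL2Deriv ν r p ((Q 0 : Measure Z)[fun z => (A z - p 0 z) * g z | m]) := by
  have hpm : ∀ ε, Measurable (p ε) := fun ε => ((hp ε).mono hm).measurable
  have hB : ∀ z, |A z - p 0 z| ≤ 1 := fun z => by
    rw [abs_le]; constructor <;> linarith [(hA01 z).1, (hA01 z).2, (hp01 0 z).1, (hp01 0 z).2]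
  have hdm : Measurable ((Q 0 : Measure Z)[fun z => (A z - p 0 z) * g z | m]) :=
    (stronglyMeasurable_condExp.mono hm).measurable
  refine ⟨hpm, ⟨1, zero_le_one, fun ε z => ?_⟩, hdm, ?_,
    M.l2Tendsto_condExp_quot hm hA hA01 hpA hp hp01⟩
  · rw [abs_of_nonneg (hp01 ε z).1]; exact (hp01 ε z).2
  · rw [M.memLp_mul_iff hdm]
    exact MemLp.condExp (by norm_num)
      (memLp_bdd_mul M.memLp_score (hA.sub (hpm 0)).aestronglyMeasurable hB)

/-- Scores have mean zero. -/
lemma integral_score (M : RootModel ν r Q g) : ∫ z, g z ∂(Q 0 : Measure Z) = 0 := by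
  have hm : ∀ ε, MemLp (fun z => (1 : ℝ) * r ε z) 2 ν := fun ε => by
    simpa using M.memLp_root ε
  have h := M.hasDerivAt_integral_mul (k := fun _ _ => 1) (k' := 0) (Y := fun _ => 1)
    (HasL2Deriv.const (C := 1) measurable_const (by simp)) measurable_const (C := 1)
    (Eventually.of_forall hm) (Eventually.of_forall fun ε => by
      have := M.eLpNorm_eq ε (fun _ => 1) measurable_const
      rw [l2norm, ← this]
      rw [eLpNorm_const _ (by norm_num) (NeZero.ne _)]; simp)
  simp only [mul_one, integral_const, probReal_univ, smul_eq_mul, Pi.zero_apply, mul_zero, one_mul,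
    zero_add] at h
  exact h.unique (hasDerivAt_const _ _)

end RootModel

end Efficiency

namespace Incremental

open Efficiency

section InfluenceFunction

variable {T : ℕ} {X : Fin T → Type*} [∀ t, MeasurableSpace (X t)] {δ : ℝ}

/-- The weighted outcome. -/
noncomputable def weightedOutcome (δ : ℝ) (P : ProbabilityMeasure (Obs X)) (z : Obs X) : ℝ :=
  (∏ t : Fin T, weight δ P t z.1) * z.2

/-- The centred treatment. -/
noncomputable def residual (P : ProbabilityMeasure (Obs X)) (t : Fin T) (z : Obs X) : ℝ :=
  ind (z.1.2 t) - propensity P t z.1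

/-- The weighted outcome, scaled by `(1 - δ) / (δ π_t + 1 - π_t)`. -/
noncomputable def scaledOutcome (δ : ℝ) (P : ProbabilityMeasure (Obs X)) (t : Fin T)
    (z : Obs X) : ℝ :=
  (1 - δ) / denom δ P t z.1 * weightedOutcome δ P z

lemma measurable_residual (P : ProbabilityMeasure (Obs X)) (t : Fin T) :
    Measurable (residual P t) :=
  ((measurable_ind_treatment t).comp measurable_fst).sub
    ((measurable_propensity P t).comp measurable_fst)

lemma abs_residual_le (P : ProbabilityMeasure (Obs X)) (t : Fin T) (z : Obs X) :
    |residual P t z| ≤ 1 := by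
  obtain ⟨h0, h1⟩ := propensity_mem_Icc P t z.1
  unfold residual
  rcases ind_eq_zero_or_one (z.1.2 t) with h | h <;> rw [h, abs_le] <;> constructor <;> linarith

lemma memLp_weightedOutcome (hδ : 0 < δ) {P : ProbabilityMeasure (Obs X)}
    (hY : MemLp (fun z : Obs X => z.2) 2 (P : Measure (Obs X))) :
    MemLp (weightedOutcome δ P) 2 (P : Measure (Obs X)) :=
  memLp_bdd_mul hY ((measurable_prod_weight P _).comp measurable_fst).aestronglyMeasurable
    fun z => abs_prod_weight_le hδ P _ z.1

lemma abs_scale_le (hδ : 0 < δ) (P : ProbabilityMeasure (Obs X)) (t : Fin T) (w : Traj X) :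
    |(1 - δ) / denom δ P t w| ≤ |1 - δ| / min 1 δ := by
  rw [abs_div, abs_of_pos (denom_pos hδ P t w)]
  exact div_le_div_of_nonneg_left (abs_nonneg _) (lt_min one_pos hδ) (le_denom P t w)

lemma measurable_scale (P : ProbabilityMeasure (Obs X)) (t : Fin T) :
    Measurable (fun w : Traj X => (1 - δ) / denom δ P t w) :=
  measurable_const.div (measurable_denom P t)

lemma memLp_scaledOutcome (hδ : 0 < δ) {P : ProbabilityMeasure (Obs X)}
    (hY : MemLp (fun z : Obs X => z.2) 2 (P : Measure (Obs X))) (t : Fin T) :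
    MemLp (scaledOutcome δ P t) 2 (P : Measure (Obs X)) :=
  memLp_bdd_mul (memLp_weightedOutcome hδ hY)
    ((measurable_scale P t).comp measurable_fst).aestronglyMeasurable
    fun z => abs_scale_le hδ P t z.1

lemma memLp_residual_mul_condExp (hδ : 0 < δ) {P : ProbabilityMeasure (Obs X)}
    (hY : MemLp (fun z : Obs X => z.2) 2 (P : Measure (Obs X))) (t : Fin T) :
    MemLp (fun z => residual P t z *
      ((P : Measure (Obs X))[scaledOutcome δ P t | restrAlg X (Set.Iic t) (Set.Iio t)]) z) 2
      (P : Measure (Obs X)) :=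
  memLp_bdd_mul ((memLp_scaledOutcome hδ hY t).condExp (by norm_num))
    (measurable_residual P t).aestronglyMeasurable (abs_residual_le P t)

variable [∀ t, Nonempty (X t)]

lemma condExp_residual (P : ProbabilityMeasure (Obs X)) (t : Fin T) :
    (P : Measure (Obs X))[residual P t | restrAlg X (Set.Iic t) (Set.Iio t)]
      =ᵐ[(P : Measure (Obs X))] 0 := by
  have hA : Integrable (fun z : Obs X => ind (z.1.2 t)) (P : Measure (Obs X)) :=
    Integrable.of_bound ((measurable_ind_treatment t).comp measurable_fst).aestronglyMeasurable 1
      (Eventually.of_forall fun z => by rcases ind_eq_zero_or_one (z.1.2 t) with h | h <;> simp [h])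
  have hp : Integrable (fun z : Obs X => propensity P t z.1) (P : Measure (Obs X)) :=
    Integrable.of_bound ((measurable_propensity P t).comp measurable_fst).aestronglyMeasurable 1
      (Eventually.of_forall fun z => by
        obtain ⟨h0, h1⟩ := propensity_mem_Icc P t z.1
        rwa [Real.norm_eq_abs, abs_of_nonneg h0])
  have h1 := condExp_sub hA hp (restrAlg X (Set.Iic t) (Set.Iio t))
  have h2 := condExp_of_stronglyMeasurable (μ := (P : Measure (Obs X)))
    (restrAlg_le (Set.Iic t) (Set.Iio t))
    ((dependsOnly_propensity P t).stronglyMeasurable (measurable_propensity P t)) hp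
  rw [h2] at h1
  refine EventuallyEq.trans h1 ?_
  filter_upwards [condExp_treatment P t] with z hz
  simp [hz]

/-- Differentiability of the weights along a model. -/
lemma hasL2Deriv_weight (hδ : 0 < δ) {ν : Measure (Obs X)} {r : ℝ → Obs X → ℝ}
    {Q : ℝ → ProbabilityMeasure (Obs X)} {g : Obs X → ℝ} (M : RootModel ν r Q g) (t : Fin T) :
    RootModel.HasL2Deriv ν r (fun ε z => weight δ (Q ε) t z.1) (fun z => weight δ (Q 0) t z.1 *
      ((1 - δ) / denom δ (Q 0) t z.1 * ((Q 0 : Measure (Obs X))[fun z => residual (Q 0) t z * g z |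
        restrAlg X (Set.Iic t) (Set.Iio t)]) z)) := by
  have hp := M.hasL2Deriv_condExp (m := restrAlg X (Set.Iic t) (Set.Iio t)) (restrAlg_le _ _)
    (A := fun z => ind (z.1.2 t)) (p := fun ε z => propensity (Q ε) t z.1)
    ((measurable_ind_treatment t).comp measurable_fst)
    (fun z => by rcases ind_eq_zero_or_one (z.1.2 t) with h | h <;> simp [h])
    (fun ε => condExp_treatment (Q ε) t)
    (fun ε => (dependsOnly_propensity (Q ε) t).stronglyMeasurable (measurable_propensity (Q ε) t))
    (fun ε z => propensity_mem_Icc (Q ε) t z.1)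
  have hden : ∀ ε z, 1 + (δ - 1) * propensity (Q ε) t z = denom δ (Q ε) t z := fun ε z => by
    unfold denom; ring
  have hD := (hp.affine M 1 (δ - 1))
  simp only [hden] at hD
  have hi := hD.inv M (lt_min one_pos hδ) (fun ε z => le_denom (Q ε) t z.1)
  have hc := RootModel.HasL2Deriv.const (ν := ν) (r := r)
    (k := fun z : Obs X => δ * ind (z.1.2 t) + 1 - ind (z.1.2 t)) (by
      have : Measurable (fun z : Obs X => ind (z.1.2 t)) :=
        (measurable_ind_treatment t).comp measurable_fst
      exact ((this.const_mul δ).add_const 1).sub this)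
    (fun z => abs_treatment_factor_le hδ (z.1.2 t))
  have h := (hc.mul M hi).congr_deriv (k'' := fun z => weight δ (Q 0) t z.1 *
      ((1 - δ) / denom δ (Q 0) t z.1 * ((Q 0 : Measure (Obs X))[fun z => residual (Q 0) t z * g z |
        restrAlg X (Set.Iic t) (Set.Iio t)]) z)) fun z => by
    have hD := (denom_pos hδ (Q 0) t z.1).ne'
    simp only [Pi.zero_apply, zero_mul, zero_add, weight, residual]
    field_simp
    ring
  simpa only [weight, div_eq_mul_inv] using h

variable [∀ t, StandardBorelSpace (X t)]

lemma eif_eq (hδ : 0 < δ) (P : ProbabilityMeasure (Obs X)) (z : Obs X) :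
    eif δ P z = ∑ t : Fin T, residual P t z * ((1 - δ) / denom δ P t z.1 *
        ((∏ s ∈ Finset.Iio t, weight δ P s z.1) * histReg δ P t z.1))
      + weightedOutcome δ P z - effect δ P := by
  unfold eif weightedOutcome
  congr 2
  refine Finset.sum_congr rfl fun t _ => ?_
  have hp : ∏ s ∈ Finset.Iic t, weight δ P s z.1 =
      weight δ P t z.1 * ∏ s ∈ Finset.Iio t, weight δ P s z.1 := by
    rw [← Finset.Iio_insert, Finset.prod_insert (by simp)]
  rw [hp]
  have hD := (denom_pos hδ P t z.1).ne'
  have e : ((ind (z.1.2 t) * (1 - propensity P t z.1)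
      - (1 - ind (z.1.2 t)) * δ * propensity P t z.1) * ((1 - δ) / δ)) * weight δ P t z.1 =
      residual P t z * ((1 - δ) / denom δ P t z.1) := by
    unfold residual weight
    rcases ind_eq_zero_or_one (z.1.2 t) with h | h <;> rw [h] <;> field_simp <;> ring
  calc _ = (((ind (z.1.2 t) * (1 - propensity P t z.1)
      - (1 - ind (z.1.2 t)) * δ * propensity P t z.1) * ((1 - δ) / δ)) * weight δ P t z.1) *
      ((∏ s ∈ Finset.Iio t, weight δ P s z.1) * histReg δ P t z.1) := by
        unfold histReg; ring
    _ = _ := by rw [e]; ring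

lemma condExp_scaledOutcome (hδ : 0 < δ) {P : ProbabilityMeasure (Obs X)}
    (hY : MemLp (fun z : Obs X => z.2) 2 (P : Measure (Obs X))) (t : Fin T) :
    (P : Measure (Obs X))[scaledOutcome δ P t | restrAlg X (Set.Iic t) (Set.Iio t)]
      =ᵐ[(P : Measure (Obs X))] fun z => (1 - δ) / denom δ P t z.1 *
        ((∏ s ∈ Finset.Iio t, weight δ P s z.1) * histReg δ P t z.1) := by
  have hd : DependsOnly (Set.Iic t) (Set.Iio t) (fun w : Traj X => (1 - δ) / denom δ P t w) :=
    fun w w' h1 h2 => by simp only [dependsOnly_denom P t w w' h1 h2]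
  refine (condExp_mul_of_stronglyMeasurable_left (hd.stronglyMeasurable (measurable_scale P t))
    ((memLp_scaledOutcome hδ hY t).integrable (by norm_num))
    ((memLp_weightedOutcome hδ hY).integrable (by norm_num))).trans ?_
  filter_upwards [condExp_weighted_hist hδ (hY.integrable (by norm_num)) t] with z hz
  rw [Pi.mul_apply]
  congr 1

/-- Projection form of the influence function. -/
lemma eif_ae_eq (hδ : 0 < δ) {P : ProbabilityMeasure (Obs X)}
    (hY : MemLp (fun z : Obs X => z.2) 2 (P : Measure (Obs X))) :
    eif δ P =ᵐ[(P : Measure (Obs X))] fun z => ∑ t : Fin T, residual P t z *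
        ((P : Measure (Obs X))[scaledOutcome δ P t | restrAlg X (Set.Iic t) (Set.Iio t)]) z
      + weightedOutcome δ P z - effect δ P := by
  have h : ∀ᵐ z ∂(P : Measure (Obs X)), ∀ t,
      ((P : Measure (Obs X))[scaledOutcome δ P t | restrAlg X (Set.Iic t) (Set.Iio t)]) z =
        (1 - δ) / denom δ P t z.1 *
        ((∏ s ∈ Finset.Iio t, weight δ P s z.1) * histReg δ P t z.1) :=
    ae_all_iff.2 fun t => condExp_scaledOutcome hδ hY t
  filter_upwards [h] with z hz
  rw [eif_eq hδ]
  simp only [hz]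

lemma memLp_eif (hδ : 0 < δ) {P : ProbabilityMeasure (Obs X)}
    (hY : MemLp (fun z : Obs X => z.2) 2 (P : Measure (Obs X))) :
    MemLp (eif δ P) 2 (P : Measure (Obs X)) := by
  rw [memLp_congr_ae (eif_ae_eq hδ hY)]
  exact ((memLp_finsetSum _ fun t _ => memLp_residual_mul_condExp hδ hY t).add
    (memLp_weightedOutcome hδ hY)).sub (memLp_const _)

lemma integral_eif (hδ : 0 < δ) {P : ProbabilityMeasure (Obs X)}
    (hY : MemLp (fun z : Obs X => z.2) 2 (P : Measure (Obs X))) :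
    ∫ z, eif δ P z ∂(P : Measure (Obs X)) = 0 := by
  have i1 : ∀ t : Fin T, Integrable (fun z => residual P t z *
      ((P : Measure (Obs X))[scaledOutcome δ P t | restrAlg X (Set.Iic t) (Set.Iio t)]) z)
      (P : Measure (Obs X)) := fun t =>
    (memLp_residual_mul_condExp hδ hY t).integrable (by norm_num)
  have i2 := (memLp_weightedOutcome hδ hY).integrable (q := 2) (by norm_num)
  have i12 := (integrable_finsetSum Finset.univ fun t _ => i1 t).add i2
  simp only [Pi.add_def] at i12
  have h0 : ∀ t : Fin T, ∫ z, residual P t z *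
      ((P : Measure (Obs X))[scaledOutcome δ P t | restrAlg X (Set.Iic t) (Set.Iio t)]) z
      ∂(P : Measure (Obs X)) = 0 := fun t => by
    rw [← integral_condExp_mul_comm (restrAlg_le _ _)
      (MemLp.of_bound (measurable_residual P t).aestronglyMeasurable 1
        (Eventually.of_forall (abs_residual_le P t))) (memLp_scaledOutcome hδ hY t)]
    refine integral_eq_zero_of_ae ?_
    filter_upwards [condExp_residual P t] with z hz
    simp [hz]
  rw [integral_congr_ae (eif_ae_eq hδ hY), integral_sub i12 (integrable_const _),
    integral_add (integrable_finsetSum _ fun t _ => i1 t) i2,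
    integral_finsetSum _ fun t _ => i1 t, effect_eq_integral hδ (hY.integrable (by norm_num))]
  simp [h0, weightedOutcome]

/-- The pathwise derivative of the incremental effect. -/
theorem hasDerivAt_effect (hδ : 0 < δ) {P : ProbabilityMeasure (Obs X)}
    (hY : MemLp (fun z : Obs X => z.2) 2 (P : Measure (Obs X)))
    {Q : ℝ → ProbabilityMeasure (Obs X)} {g : Obs X → ℝ} (hQ : Submodel P Q g) :
    HasDerivAt (fun ε => effect δ (Q ε)) (∫ z, eif δ P z * g z ∂(P : Measure (Obs X))) 0 := by
  obtain ⟨hsub, C, hC⟩ := hQ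
  obtain ⟨ν, r, g', hg, M⟩ := hsub.exists_rootModel
  have hb := hsub.base
  subst hb
  have hYmeas : Measurable (fun z : Obs X => z.2) := measurable_snd
  have hnorm : ∀ᶠ ε in 𝓝 0, eLpNorm (fun z : Obs X => z.2) 2 (Q ε : Measure (Obs X)) ≤
      (C : ℝ≥0∞) ^ (1 / 2 : ℝ) := by
    filter_upwards [hC] with ε h
    rw [eLpNorm_eq_lintegral_rpow_enorm_toReal (by norm_num) (by norm_num)]
    simp only [ENNReal.toReal_ofNat, ENNReal.rpow_ofNat]
    exact ENNReal.rpow_le_rpow h (by norm_num)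
  have hCtop : (C : ℝ≥0∞) ^ (1 / 2 : ℝ) ≠ ∞ :=
    ENNReal.rpow_ne_top_of_nonneg (by norm_num) ENNReal.coe_ne_top
  have hYL : ∀ᶠ ε in 𝓝 0, MemLp (fun z : Obs X => z.2) 2 (Q ε : Measure (Obs X)) :=
    hnorm.mono fun ε h => ⟨hYmeas.aestronglyMeasurable, h.trans_lt hCtop.lt_top⟩
  have hYm : ∀ᶠ ε in 𝓝 0, MemLp (fun z : Obs X => z.2 * r ε z) 2 ν :=
    hYL.mono fun ε h => (M.memLp_mul_iff hYmeas).2 h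
  have hYC : ∀ᶠ ε in 𝓝 0, l2norm ν (fun z : Obs X => z.2 * r ε z) ≤
      ((C : ℝ≥0∞) ^ (1 / 2 : ℝ)).toReal := by
    filter_upwards [hnorm] with ε h
    rw [l2norm, ← M.eLpNorm_eq ε _ hYmeas]
    exact ENNReal.toReal_mono hCtop h
  have hW := RootModel.HasL2Deriv.prod M Finset.univ fun t _ => hasL2Deriv_weight hδ M t
  have hder := M.hasDerivAt_integral_mul hW hYmeas hYm hYC
  have heff : (fun ε => effect δ (Q ε)) =ᶠ[𝓝 0] fun ε =>
      ∫ z, (∏ t : Fin T, weight δ (Q ε) t z.1) * z.2 ∂(Q ε : Measure (Obs X)) :=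
    hYL.mono fun ε h => effect_eq_integral hδ (h.integrable (by norm_num))
  refine (hder.congr_of_eventuallyEq heff).congr_deriv ?_
  set P := Q 0
  set μ := (P : Measure (Obs X))
  have mg : MemLp g' 2 μ := M.memLp_score
  have mrg : ∀ t : Fin T, MemLp (fun z => residual P t z * g' z) 2 μ := fun t =>
    memLp_bdd_mul mg (measurable_residual P t).aestronglyMeasurable (abs_residual_le P t)
  have hswap : ∀ t : Fin T, ∫ z, (μ[fun z => residual P t z * g' z |
        restrAlg X (Set.Iic t) (Set.Iio t)]) z * scaledOutcome δ P t z ∂μ =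
      ∫ z, residual P t z * (μ[scaledOutcome δ P t | restrAlg X (Set.Iic t) (Set.Iio t)]) z *
        g' z ∂μ := fun t => by
    rw [integral_condExp_mul_comm (restrAlg_le _ _) (mrg t) (memLp_scaledOutcome hδ hY t)]
    congr 1; funext z; ring
  have j1 : ∀ t : Fin T, Integrable (fun z => (μ[fun z => residual P t z * g' z |
        restrAlg X (Set.Iic t) (Set.Iio t)]) z * scaledOutcome δ P t z) μ := fun t =>
    integrable_mul_of_memLp ((mrg t).condExp (by norm_num)) (memLp_scaledOutcome hδ hY t)
  have j2 : ∀ t : Fin T, Integrable (fun z => residual P t z *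
      (μ[scaledOutcome δ P t | restrAlg X (Set.Iic t) (Set.Iio t)]) z * g' z) μ := fun t =>
    integrable_mul_of_memLp (memLp_residual_mul_condExp hδ hY t) mg
  have j3 : Integrable (fun z => weightedOutcome δ P z * g' z) μ :=
    integrable_mul_of_memLp (memLp_weightedOutcome hδ hY) mg
  have j4 : Integrable (fun z => effect δ P * g' z) μ :=
    (mg.integrable (by norm_num)).const_mul _
  have e1 : ∫ z, eif δ P z * g z ∂μ = ∑ t : Fin T, ∫ z, residual P t z *
      (μ[scaledOutcome δ P t | restrAlg X (Set.Iic t) (Set.Iio t)]) z * g' z ∂μ +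
      ∫ z, weightedOutcome δ P z * g' z ∂μ := by
    have e : (fun z => eif δ P z * g z) =ᵐ[μ] fun z => ∑ t : Fin T, residual P t z *
        (μ[scaledOutcome δ P t | restrAlg X (Set.Iic t) (Set.Iio t)]) z * g' z +
        weightedOutcome δ P z * g' z - effect δ P * g' z := by
      filter_upwards [eif_ae_eq hδ hY, hg] with z h1 h2
      rw [h1, h2, ← Finset.sum_mul]
      ring
    have j23 := (integrable_finsetSum Finset.univ fun t _ => j2 t).add j3
    simp only [Pi.add_def] at j23
    rw [integral_congr_ae e, integral_sub j23 j4,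
      integral_add (integrable_finsetSum _ fun t _ => j2 t) j3,
      integral_finsetSum _ fun t _ => j2 t, integral_const_mul, M.integral_score]
    simp
  rw [e1]
  congr 1
  rw [← Finset.sum_congr rfl fun t _ => hswap t, ← integral_finsetSum _ fun t _ => j1 t]
  congr 1; funext z
  rw [Finset.mul_sum, Finset.sum_mul]
  refine Finset.sum_congr rfl fun t _ => ?_
  simp only [scaledOutcome, weightedOutcome]
  ring

theorem isEIF_eif (hδ : 0 < δ) {P : ProbabilityMeasure (Obs X)}
    (hY : MemLp (fun z : Obs X => z.2) 2 (P : Measure (Obs X))) :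
    IsEIF (Submodel P) (effect δ) P (eif δ P) where
  memLp := memLp_eif hδ hY
  mean_zero := integral_eif hδ hY
  pathwise _ _ hQ := hasDerivAt_effect hδ hY hQ
  tangent η hη := by
    obtain ⟨h, hm, ⟨K, hK⟩, h0, hlt⟩ :=
      exists_bounded_mean_zero (memLp_eif hδ hY) (integral_eif hδ hY) hη
    exact ⟨h, Submodule.subset_span ⟨_, submodel_tilt hY hm hK h0⟩, hlt⟩

end InfluenceFunction

end Incremental

theorem theorem2 {T : ℕ} {X : Fin T → Type*} [∀ t, MeasurableSpace (X t)]
    [∀ t, StandardBorelSpace (X t)] [∀ t, Nonempty (X t)]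
    (P : ProbabilityMeasure (Incremental.Obs X))
    (hY : MemLp (fun z : Incremental.Obs X => z.2) 2 (P : Measure (Incremental.Obs X)))
    (δ : ℝ) (hδ : 0 < δ) :
    Efficiency.IsEIF (Incremental.Submodel P) (Incremental.effect δ) P (Incremental.eif δ P) ∧
      ∀ φ : Incremental.Obs X → ℝ,
        Efficiency.IsEIF (Incremental.Submodel P) (Incremental.effect δ) P φ →
          φ =ᵐ[(P : Measure (Incremental.Obs X))] Incremental.eif δ P :=
  ⟨Incremental.isEIF_eif hδ hY, fun _ hφ =>
    Incremental.isEIF_unique hY hφ (Incremental.isEIF_eif hδ hY)⟩
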